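/- Let $K$ be a field, and let $K_0(\mathcal V_K)$ be the Grothendieck ring of varieties over $K$: the abelian group generated by isomorphism classes $[X]$ of varieties over $K$ modulo $[X]=[Y]+[X\smallsetminus Y]$ for closed $Y\subseteq X$, with product $[X]\cdot[Y]=[X\times Y]$. Put $\mathbb T=[\mathbb A^1\smallsetminus \mathbb A^0]$. For a finite graph $G$ (multiple edges allowed) with $m$ edges, let $\Psi_G=\sum_{\tau}\prod_{e\notin\tau}t_e$ (sum over the spanning trees $\tau$ of $G$) and let $\mathbb U(G)=[\mathbb A^m\smallsetminus\{\Psi_G=0\}]\in K_0(\mathcal V_K)$. For integers $v\ge 4$ and $n\ge 0$ let $\Gamma^v_n$ be the graph obtained as follows. Start from a single edge joining two vertices. At stage $1$ replace this edge by a string consisting of a single edge, $v-1$ parallel edges, and a single edge. At each stage $s=2,\dots,n$ replace in the same way one of the $v-1$ parallel edges created at stage $s-1$. (This is the melonic construction $((1,v-1,1),0,1),((1,v-1,1),1,2),\dots,((1,v-1,1),n-1,2)$. It can be carried out, and the choice of the edge among the parallel ones is irrelevant.) Define $$N_v(r,t)=1-\Big(\sum_{i=0}^{v-4}(-1)^{v-i}t^i\Big)r,$$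 $$D_v(r,t)=1+\Big(-v\,t^{v-3}-\sum_{i=0}^{v-3}(-1)^{v-i}(i+2)t^i\Big)r+\Big((-1)^v t^{v-4}+\sum_{i=0}^{v-4}(-1)^{v-i}(v-3-i)\,t^{v-4+i}\Big)r^2 ,$$ and let $A^v_n(t)\in\mathbb Z[t]$ be the coefficient of $r^n$ in the power series expansion of $N_v(r,t)/D_v(r,t)$ in $\mathbb Z[t][[r]]$. Then $(1+t)\,N_v(r,t)=1+t+\big((-1)^{v-3}-t^{v-3}\big)r$, and for all $v\ge4$ and $n\ge 0$ $$\mathbb U(\Gamma^v_n)=\mathbb T^n(\mathbb T+1)^{2n+1}A^v_n(\mathbb T),\qquad \deg A^v_n=(v-3)n .$$ -/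

import Mathlib

open CategoryTheory AlgebraicGeometry

noncomputable section

/-! ### The Grothendieck ring of varieties over a field -/

/-- The schemes that are separated and of finite type over `Spec K`. -/
def isVariety (K : Type*) [Field K] : ObjectProperty (Over (Spec (CommRingCat.of K))) :=
  fun X => IsSeparated X.hom ∧ LocallyOfFiniteType X.hom ∧ QuasiCompact X.hom

/-- Varieties contain the base and are stable under fibre products over `Spec K`. -/
instance isVariety.isMonoidal (K : Type*) [Field K] : (isVariety K).IsMonoidal where
  prop_unit := by
    have h : isVariety K (Over.mk (𝟙 (Spec (CommRingCat.of K)))) :=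
      ⟨inferInstanceAs (IsSeparated (𝟙 _)), inferInstanceAs (LocallyOfFiniteType (𝟙 _)),
        inferInstanceAs (QuasiCompact (𝟙 _))⟩
    exact h
  prop_tensor := by
    rintro X Y ⟨_, _, _⟩ ⟨_, _, _⟩
    refine ⟨?_, ?_, ?_⟩ <;> (rw [Over.tensorObj_hom]; infer_instance)

/-- The category of varieties over `K`, with product the fibre product over `Spec K`. -/
abbrev Variety (K : Type*) [Field K] : Type _ := (isVariety K).FullSubcategory

/-- The ring of formal `ℤ`-linear combinations of isomorphism classes of varieties, with
product induced by `X × Y`. -/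
abbrev FreeVarietyRing (K : Type*) [Field K] : Type _ :=
  MonoidAlgebra ℤ (Skeleton (Variety K))

/-- The generator of `FreeVarietyRing K` given by the isomorphism class of `X`. -/
def FreeVarietyRing.of {K : Type*} [Field K] (X : Variety K) : FreeVarietyRing K :=
  MonoidAlgebra.single (toSkeleton X) 1

/-- The elements `[X] - [Y] - [X ∖ Y]`, for `Y` a closed subvariety of `X`. The set is stable
under multiplication by classes of varieties, so the ideal it generates is the subgroup it
generates. -/
def scissorRelations (K : Type*) [Field K] : Set (FreeVarietyRing K) :=
  {a | ∃ (X Y U : Variety K) (i : Y ⟶ X) (j : U ⟶ X),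
    IsClosedImmersion i.hom.left ∧ IsOpenImmersion j.hom.left ∧
    Set.range j.hom.left = (Set.range i.hom.left)ᶜ ∧
    a = FreeVarietyRing.of X - FreeVarietyRing.of Y - FreeVarietyRing.of U}

/-- The Grothendieck ring `K₀` of varieties over `K`. -/
abbrev GrothendieckRing (K : Type*) [Field K] : Type _ :=
  FreeVarietyRing K ⧸ Ideal.span (scissorRelations K)

/-- The class `[X]` of a variety. -/
def GrothendieckRing.cls {K : Type*} [Field K] (X : Variety K) : GrothendieckRing K :=
  Ideal.Quotient.mk _ (FreeVarietyRing.of X)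

/-- The complement `{p ≠ 0}` of the affine hypersurface `p = 0`, as an open subset of the affine
space over `K` with coordinates indexed by `σ`. -/
def complementOpen (K : Type*) [Field K] {σ : Type} (p : MvPolynomial σ K) :
    (Spec (CommRingCat.of (MvPolynomial σ K))).Opens :=
  PrimeSpectrum.basicOpen p

/-- The complement `{p ≠ 0}` of the affine hypersurface `p = 0`, as an open subvariety of the
affine space. -/
def hypersurfaceComplement (K : Type*) [Field K] {σ : Type} [Finite σ] (p : MvPolynomial σ K) :
    Variety K where
  obj := Over.mk ((complementOpen K p).ι ≫
    Spec.map (CommRingCat.ofHom (algebraMap K (MvPolynomial σ K))))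
  property := by
    have hf : (algebraMap K (MvPolynomial σ K)).FiniteType :=
      RingHom.finiteType_algebraMap.2 inferInstance
    have h1 : LocallyOfFiniteType
        (Spec.map (CommRingCat.ofHom (algebraMap K (MvPolynomial σ K)))) := by
      rw [HasRingHomProperty.Spec_iff (P := @LocallyOfFiniteType)]
      exact hf
    have h2 : QuasiCompact (complementOpen K p).ι := inferInstance
    refine ⟨?_, ?_, ?_⟩ <;> simp only [Over.mk_hom] <;> infer_instance

/-- The class `𝕋 = [𝔸¹ ∖ 𝔸⁰]` of the torus. -/
def torusClass (K : Type*) [Field K] : GrothendieckRing K :=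
  GrothendieckRing.cls (hypersurfaceComplement K (MvPolynomial.X () : MvPolynomial Unit K))

/-! ### Graphs and the Kirchhoff–Symanzik polynomial -/

/-- A graph with finitely many edges; parallel edges and loops are allowed. Each edge carries an
orientation, which only serves to fix the order in which strings of bananas are inserted. -/
structure Multigraph where
  V : Type
  E : Type
  [fintypeE : Fintype E]
  src : E → V
  tgt : E → V

attribute [instance] Multigraph.fintypeE

namespace Multigraph

/-- Two vertices are joined by a path (ignoring orientations) with edges in `S`. -/
def Joined (G : Multigraph) (S : Set G.E) : G.V → G.V → Prop :=
  Relation.EqvGen fun a b => ∃ e ∈ S, G.src e = a ∧ G.tgt e = b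

/-- `S` is the set of edges of a spanning tree: it connects all vertices and contains no cycle,
i.e., the ends of an edge in `S` are not joined by the other edges in `S`. -/
def IsSpanningTree (G : Multigraph) (S : Set G.E) : Prop :=
  (∀ a b, G.Joined S a b) ∧ ∀ e ∈ S, ¬ G.Joined (S \ {e}) (G.src e) (G.tgt e)

open Classical in
/-- The Kirchhoff–Symanzik polynomial `∑_T ∏_{e ∉ T} t_e`, over the spanning trees `T`. -/
def symanzik (K : Type*) [Field K] (G : Multigraph) : MvPolynomial G.E K :=
  ∑ S : Finset G.E,
    if G.IsSpanningTree (S : Set G.E) then ∏ e ∈ Finset.univ \ S, MvPolynomial.X e else 0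

/-- The Grothendieck class `𝕌(G)` of the complement of the affine graph hypersurface. -/
def grothendieckClass (K : Type*) [Field K] (G : Multigraph) : GrothendieckRing K :=
  GrothendieckRing.cls (hypersurfaceComplement K (G.symanzik K))

end Multigraph

/-! ### Melonic graphs -/

/-- A graph whose edges remember the banana they belong to: an edge labeled `(p, k)` is an edge of
the `k`-th banana constructed at stage `p`. -/
structure BananaGraph extends Multigraph where
  label : E → ℕ × ℕ

/-- The graph at stage `0`: a single edge joining two vertices, labeled `(0, 1)`. -/
def BananaGraph.singleEdge : BananaGraph where
  V := Bool
  E := Unit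
  src _ := false
  tgt _ := true
  label _ := (0, 1)

namespace BananaGraph

/-- The `j`-th vertex on a string of `r` bananas replacing the edge `e`, for `0 ≤ j ≤ r`: the
vertices with `0 < j < r` are new, the others are the ends of `e`. -/
def joint (G : BananaGraph) (e : G.E) (r j : ℕ) : G.V ⊕ Fin (r - 1) :=
  if j = 0 then Sum.inl (G.src e)
  else if h : j - 1 < r - 1 then Sum.inr ⟨j - 1, h⟩
  else Sum.inl (G.tgt e)

open Classical in
/-- Replace the edge `e` by a string of bananas of sizes `b = (a₁, …, a_r)`; the edges of the
`k`-th of these bananas are labeled `(s, k)`. -/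
def bananify (G : BananaGraph) (e : G.E) (b : List ℕ) (s : ℕ) : BananaGraph where
  V := G.V ⊕ Fin (b.length - 1)
  E := {x : G.E // x ≠ e} ⊕ (Σ j : Fin b.length, Fin (b.get j))
  src := Sum.elim (fun x => Sum.inl (G.src x)) (fun y => G.joint e b.length y.1)
  tgt := Sum.elim (fun x => Sum.inl (G.tgt x)) (fun y => G.joint e b.length (y.1 + 1))
  label := Sum.elim (fun x => G.label x) (fun y => (s, y.1 + 1))

end BananaGraph

/-- A tuple `((a₁, …, a_r), p, k)`: replace an edge of the `k`-th banana constructed at stage `p`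
by a string of bananas of sizes `a₁, …, a_r`. -/
structure MelonicTuple where
  sizes : List ℕ
  stage : ℕ
  banana : ℕ

/-- `IsMelonicGraph T G`: the list of tuples `T` is a melonic construction and `G` is a graph
obtained from it, by performing at stage `s` the replacement prescribed by the `s`-th tuple on some
edge of the required banana. Each tuple of sizes is non-empty, with positive entries; the other
restrictions on a melonic construction (`p_s < s`, `k_s` is at most the number of bananas constructed
at stage `p_s`, the initial edge is replaced once, at most `a` edges of an `a`-banana are replaced)
say exactly that such an edge is available at each stage. -/
inductive IsMelonicGraph : List MelonicTuple → BananaGraph → Prop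
  | nil : IsMelonicGraph [] BananaGraph.singleEdge
  | snoc {T : List MelonicTuple} {G : BananaGraph} (hG : IsMelonicGraph T G) (t : MelonicTuple)
      (hne : t.sizes ≠ []) (hpos : ∀ a ∈ t.sizes, 0 < a)
      (e : G.E) (he : G.label e = (t.stage, t.banana)) :
      IsMelonicGraph (T ++ [t]) (G.bananify e t.sizes (T.length + 1))

/-- The melonic construction
`((1, v-1, 1), 0, 1), ((1, v-1, 1), 1, 2), …, ((1, v-1, 1), n-1, 2)` of the graph `Γᵛₙ`. -/
def gammaConstruction (v n : ℕ) : List MelonicTuple :=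
  (List.range n).map fun p => ⟨[1, v - 1, 1], p, if p = 0 then 1 else 2⟩

/-! ### The rational generating function -/

section GeneratingFunction

open Polynomial

/-- The numerator `N(r, t)`, as a power series in `r` over `ℤ[t]`. -/
def seriesN (v : ℕ) : PowerSeries ℤ[X] :=
  1 - PowerSeries.C (∑ i ∈ Finset.range (v - 3), (-1) ^ (v - i) * X ^ i) * PowerSeries.X

/-- The denominator `D(r, t)`, as a power series in `r` over `ℤ[t]`. -/
def seriesD (v : ℕ) : PowerSeries ℤ[X] :=
  1 + PowerSeries.C (-(v : ℤ[X]) * X ^ (v - 3)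
        - ∑ i ∈ Finset.range (v - 2), (-1) ^ (v - i) * ((i : ℤ[X]) + 2) * X ^ i) * PowerSeries.X
    + PowerSeries.C ((-1) ^ v * X ^ (v - 4)
        + ∑ i ∈ Finset.range (v - 3), (-1) ^ (v - i) * ((v : ℤ[X]) - 3 - (i : ℤ[X])) * X ^ (v - 4 + i))
      * PowerSeries.X ^ 2

/-- The polynomial `Aᵛₙ(t)`: the coefficient of `rⁿ` in the expansion of `N(r, t) / D(r, t)`. -/
def polyA (v n : ℕ) : ℤ[X] :=
  PowerSeries.coeff n (seriesN v * PowerSeries.invOfUnit (seriesD v) 1)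

/-- `D` has constant term `1`, so the inverse used in `polyA` is its inverse. -/
theorem seriesD_mul_inv (v : ℕ) : seriesD v * PowerSeries.invOfUnit (seriesD v) 1 = 1 := by
  apply PowerSeries.mul_invOfUnit
  simp [seriesD]

end GeneratingFunction

end

/-! Fix an edge e of G and sort the spanning trees by whether they contain e. This gives Ψ_G = a t_e
+ b, where a = Ψ_{G∖e} and b = Ψ_{G/e} involve only the other variables; a = 0 if e is a bridge and
b = 0 if e is a loop. Let x, y, w be the classes of {a ≠ 0, b ≠ 0}, {a ≠ 0, b = 0}, {a = 0, b ≠ 0}.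
Over each locus the condition a t_e + b ≠ 0 removes a point from the line or nothing, so 𝕌(G) = T(x
+ y) + (T + 1)w.

The triple (x, y, w), the state at e, changes linearly under two operations. Adding an edge z
parallel to e turns (a, b) into (az + b, bz) (`pairState_parallel`). Subdividing e by z turns it
into (a, az + b) (`pairState_series`). Replacing e by the string 1, v-1, 1, seen from one of the
parallel edges, is two subdivisions followed by v-2 doublings (`stateAt_middleEdge`). Hence the
state of Γᵛₙ is the n-th iterate of one linear map at (0, 0, 1), the state of a single edge.

A subdivision depends only on x + y and w, so this map is governed by a 2 × 2 matrix, and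
Cayley–Hamilton yields a second-order recursion for 𝕌 (`totalClass_stringStep_stringStep`). Write D
= 1 + D₁r + D₂r². The trace and determinant of the matrix are -T(T+1)²D₁(T) and T²(T+1)⁴D₂(T), so
this is the recursion of the coefficients of N/D with r rescaled by T(T+1)². The degree follows
because D₁ has leading term -t^(v-3) and D₂ has degree below 2(v-3). -/

open CategoryTheory AlgebraicGeometry

noncomputable section

universe u

/-! ### Classes of affine varieties in the Grothendieck ring -/

section AffineClass

variable (K : Type u) [Field K]

/-- The affine variety with coordinate ring `C`. -/
def affineVariety (C : Type u) [CommRing C] [Algebra K C] [Algebra.FiniteType K C] :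
    Variety K where
  obj := Over.mk (Spec.map (CommRingCat.ofHom (algebraMap K C)))
  property := by
    have h1 : LocallyOfFiniteType (Spec.map (CommRingCat.ofHom (algebraMap K C))) := by
      rw [HasRingHomProperty.Spec_iff (P := @LocallyOfFiniteType)]
      exact RingHom.finiteType_algebraMap.2 inferInstance
    exact ⟨inferInstanceAs (IsSeparated (Spec.map _)), h1,
      inferInstanceAs (QuasiCompact (Spec.map _))⟩

/-- The class of the affine variety with coordinate ring `C`. -/
def affineClass (C : Type u) [CommRing C] [Algebra K C] [Algebra.FiniteType K C] :
    GrothendieckRing K :=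
  GrothendieckRing.cls (affineVariety K C)

variable {K}

theorem GrothendieckRing.cls_congr {X Y : Variety K} (e : X.obj ≅ Y.obj) :
    GrothendieckRing.cls X = GrothendieckRing.cls Y := by
  unfold GrothendieckRing.cls FreeVarietyRing.of
  rw [toSkeleton_eq_toSkeleton_iff.2 ⟨ObjectProperty.isoMk _ e⟩]

theorem GrothendieckRing.cls_eq_add {X Y U : Variety K} (i : Y.obj ⟶ X.obj) (j : U.obj ⟶ X.obj)
    (hi : IsClosedImmersion i.left) (hj : IsOpenImmersion j.left)
    (h : Set.range j.left = (Set.range i.left)ᶜ) :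
    GrothendieckRing.cls X = GrothendieckRing.cls Y + GrothendieckRing.cls U := by
  unfold GrothendieckRing.cls
  rw [← map_add, Ideal.Quotient.eq]
  refine Ideal.subset_span ⟨X, Y, U, ObjectProperty.homMk i, ObjectProperty.homMk j, hi, hj, h, ?_⟩
  abel

theorem GrothendieckRing.cls_tensor (X Y : Variety K) :
    GrothendieckRing.cls (MonoidalCategory.tensorObj X Y) =
      GrothendieckRing.cls X * GrothendieckRing.cls Y := by
  unfold GrothendieckRing.cls FreeVarietyRing.of
  rw [Skeleton.toSkeleton_tensorObj, ← map_mul, MonoidAlgebra.single_mul_single, mul_one]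

theorem GrothendieckRing.cls_unit :
    GrothendieckRing.cls (MonoidalCategory.tensorUnit (Variety K)) = 1 := by
  unfold GrothendieckRing.cls FreeVarietyRing.of
  rw [← Skeleton.one_eq]
  exact map_one _

variable {C D : Type u} [CommRing C] [Algebra K C] [Algebra.FiniteType K C]
  [CommRing D] [Algebra K D] [Algebra.FiniteType K D]

theorem affineClass_congr (e : C ≃ₐ[K] D) : affineClass K C = affineClass K D := by
  refine GrothendieckRing.cls_congr (Over.isoMk
    (Scheme.Spec.mapIso e.symm.toRingEquiv.toCommRingCatIso.op) ?_)
  simp only [affineVariety, Over.mk_hom]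
  change Spec.map (CommRingCat.ofHom (e.symm : D →+* C)) ≫ Spec.map _ = Spec.map _
  rw [← Spec.map_comp, ← CommRingCat.ofHom_comp]
  congr 2
  ext x
  simp

theorem affineClass_cut (c : C) :
    affineClass K C = affineClass K (C ⧸ Ideal.span {c}) + affineClass K (Localization.Away c) := by
  refine GrothendieckRing.cls_eq_add
    (Over.homMk (Spec.map (CommRingCat.ofHom (Ideal.Quotient.mk (Ideal.span {c})))) ?_)
    (Over.homMk (Spec.map (CommRingCat.ofHom (algebraMap C (Localization.Away c)))) ?_) ?_ ?_ ?_
  · simp only [affineVariety, Over.mk_hom]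
    rw [← Spec.map_comp, ← CommRingCat.ofHom_comp, Ideal.Quotient.mk_comp_algebraMap]
  · simp only [affineVariety, Over.mk_hom]
    rw [← Spec.map_comp, ← CommRingCat.ofHom_comp, ← IsScalarTower.algebraMap_eq]
  · exact IsClosedImmersion.spec_of_quotient_mk (R := CommRingCat.of C) _
  · change IsOpenImmersion (Spec.map (CommRingCat.ofHom (algebraMap C (Localization.Away c))))
    infer_instance
  · have h1 := PrimeSpectrum.localization_away_comap_range (Localization.Away c) c
    have h2 := range_comap_of_surjective _ (Ideal.Quotient.mk (Ideal.span {c}))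
      Ideal.Quotient.mk_surjective
    rw [Ideal.mk_ker, PrimeSpectrum.zeroLocus_span] at h2
    rw [PrimeSpectrum.basicOpen_eq_zeroLocus_compl, ← h2] at h1
    exact h1

/-- Cutting the empty scheme along 0 gives [∅] = [∅] + [∅]. -/
theorem affineClass_of_subsingleton [Subsingleton C] : affineClass K C = 0 := by
  have h := affineClass_cut (K := K) (0 : C)
  rw [affineClass_congr (C := C) (D := C ⧸ Ideal.span {(0 : C)})
      (AlgEquiv.ofBijective (Ideal.Quotient.mkₐ K _)
        ⟨fun _ _ _ => Subsingleton.elim _ _, Ideal.Quotient.mk_surjective⟩)] at h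
  have : Subsingleton (Localization.Away (0 : C)) :=
    (algebraMap C (Localization.Away (0 : C))).codomain_trivial
  rw [affineClass_congr (C := C) (D := Localization.Away (0 : C))
    (AlgEquiv.ofBijective (IsScalarTower.toAlgHom K C _)
        ⟨fun _ _ _ => Subsingleton.elim _ _, fun x => ⟨0, Subsingleton.elim _ _⟩⟩)]
  simpa using h

theorem affineClass_self : affineClass K K = 1 := by
  rw [← GrothendieckRing.cls_unit]
  refine GrothendieckRing.cls_congr (Over.isoMk (Iso.refl _) ?_)
  simp only [affineVariety, Over.mk_hom]
  change 𝟙 _ ≫ 𝟙 _ = Spec.map _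
  rw [Category.comp_id]
  exact Spec.map_id _ |>.symm

open TensorProduct in
instance : Algebra.FiniteType K (C ⊗[K] D) :=
  Algebra.FiniteType.trans (S := C) inferInstance inferInstance

open TensorProduct in
theorem affineClass_tensor : affineClass K (C ⊗[K] D) = affineClass K C * affineClass K D := by
  unfold affineClass
  rw [← GrothendieckRing.cls_tensor]
  symm
  refine GrothendieckRing.cls_congr (Over.isoMk (pullbackSpecIso K C D) ?_)
  change _ = Limits.pullback.fst _ _ ≫ _
  simp only [affineVariety, Over.mk_hom]
  rw [← Iso.eq_inv_comp, pullbackSpecIso_inv_fst_assoc, ← Spec.map_comp, ← CommRingCat.ofHom_comp]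

theorem affineClass_polynomial :
    affineClass K (Polynomial C) = affineClass K C * affineClass K (Polynomial K) := by
  rw [← affineClass_tensor]
  exact affineClass_congr (polyEquivTensor K C)

/-- The open subscheme D(p) and the spectrum of the localization have the same image under open
immersions. From here on all classes can be computed with rings. -/
theorem cls_hypersurfaceComplement {σ : Type} [Finite σ] (p : MvPolynomial σ K) :
    GrothendieckRing.cls (hypersurfaceComplement K p) = affineClass K (Localization.Away p) := by
  have h : Set.range (complementOpen K p).ι =
      Set.range (Spec.map (CommRingCat.ofHom (algebraMap _ (Localization.Away p)))) := by
    rw [Scheme.Opens.range_ι]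
    exact (PrimeSpectrum.localization_away_comap_range (Localization.Away p) p).symm
  let e := IsOpenImmersion.isoOfRangeEq (complementOpen K p).ι
    (Spec.map (CommRingCat.ofHom (algebraMap _ (Localization.Away p)))) h
  refine GrothendieckRing.cls_congr (Over.isoMk e ?_)
  change e.hom ≫ Spec.map _ = (complementOpen K p).ι ≫ Spec.map _
  rw [IsScalarTower.algebraMap_eq K (MvPolynomial σ K), CommRingCat.ofHom_comp, Spec.map_comp]
  exact IsOpenImmersion.isoOfRangeEq_hom_fac_assoc _ _ _ _

theorem affineClass_polynomial_self : affineClass K (Polynomial K) = torusClass K + 1 := by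
  have h := affineClass_cut (K := K) (MvPolynomial.X () : MvPolynomial Unit K)
  rw [torusClass, cls_hypersurfaceComplement,
    ← affineClass_congr (MvPolynomial.uniqueAlgEquiv K Unit), h, add_comm]
  congr 1
  rw [← affineClass_self]
  refine affineClass_congr ((Ideal.quotientEquivAlg _ (Ideal.span {Polynomial.X - Polynomial.C 0})
    (MvPolynomial.uniqueAlgEquiv K Unit) ?_).trans (Polynomial.quotientSpanXSubCAlgEquiv (0 : K)))
  simp [Ideal.map_span]

end AffineClass

/-! ### Locally closed pieces of affine schemes -/

section Pieces

/-- `φ : B → C` exhibits `C` as the coordinate ring of the locally closed subscheme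
`V(I) ∩ D(g)` of `Spec B`, by its universal property. -/
structure IsPiece {B C : Type u} [CommRing B] [CommRing C] (φ : B →+* C) (I : Ideal B) (g : B) :
    Prop where
  zero : ∀ x ∈ I, φ x = 0
  unit : IsUnit (φ g)
  lift : ∀ {S : Type u} [CommRing S] (ψ : B →+* S), (∀ x ∈ I, ψ x = 0) → IsUnit (ψ g) →
    ∃ θ : C →+* S, θ.comp φ = ψ
  ext : ∀ {S : Type u} [CommRing S] (θ θ' : C →+* S), θ.comp φ = θ'.comp φ → θ = θ'

namespace IsPiece

variable {B C D : Type u} [CommRing B] [CommRing C] [CommRing D] {φ : B →+* C} {I : Ideal B} {g : B}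

theorem of_localization (I : Ideal B) (g : B) :
    IsPiece (algebraMap B (Localization.Away (Ideal.Quotient.mk I g))) I g where
  zero x hx := by
    rw [IsScalarTower.algebraMap_apply B (B ⧸ I), Ideal.Quotient.algebraMap_eq,
      Ideal.Quotient.eq_zero_iff_mem.2 hx, map_zero]
  unit := by
    rw [IsScalarTower.algebraMap_apply B (B ⧸ I), Ideal.Quotient.algebraMap_eq]
    exact IsLocalization.Away.algebraMap_isUnit _
  lift ψ h0 h1 := by
    refine ⟨IsLocalization.Away.lift (g := Ideal.Quotient.lift I ψ h0) (Ideal.Quotient.mk I g)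
      (by simpa using h1), ?_⟩
    ext x
    rw [RingHom.comp_apply, IsScalarTower.algebraMap_apply B (B ⧸ I), IsLocalization.Away.lift_eq]
    simp
  ext θ θ' h := by
    refine IsLocalization.ringHom_ext (Submonoid.powers (Ideal.Quotient.mk I g))
      (Ideal.Quotient.ringHom_ext ?_)
    rw [RingHom.comp_assoc, RingHom.comp_assoc]
    exact h

theorem exists_algEquiv {K : Type u} [CommRing K] [Algebra K B] [Algebra K C] [Algebra K D]
    {φ : B →ₐ[K] C} {φ' : B →ₐ[K] D} (h : IsPiece (φ : B →+* C) I g)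
    (h' : IsPiece (φ' : B →+* D) I g) : Nonempty (C ≃ₐ[K] D) := by
  obtain ⟨θ, hθ⟩ := h.lift (φ' : B →+* D) h'.zero h'.unit
  obtain ⟨θ', hθ'⟩ := h'.lift (φ : B →+* C) h.zero h.unit
  have h1 : θ'.comp θ = RingHom.id _ := h.ext _ _ (by
    rw [RingHom.comp_assoc, hθ, hθ', RingHom.id_comp])
  have h2 : θ.comp θ' = RingHom.id _ := h'.ext _ _ (by
    rw [RingHom.comp_assoc, hθ', hθ, RingHom.id_comp])
  refine ⟨AlgEquiv.ofRingEquiv (f := RingEquiv.ofRingHom θ θ' h2 h1) fun r => ?_⟩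
  rw [← φ.commutes, ← φ'.commutes]
  exact RingHom.congr_fun hθ _

theorem quotient (h : IsPiece φ I g) (c : B) :
    IsPiece ((Ideal.Quotient.mk (Ideal.span {φ c})).comp φ) (I ⊔ Ideal.span {c}) g where
  zero := by
    have : I ⊔ Ideal.span {c} ≤ RingHom.ker ((Ideal.Quotient.mk (Ideal.span {φ c})).comp φ) := by
      refine sup_le (fun x hx => ?_) ((Ideal.span_singleton_le_iff_mem _).2 ?_)
      · rw [RingHom.mem_ker, RingHom.comp_apply, h.zero x hx, map_zero]
      · rw [RingHom.mem_ker, RingHom.comp_apply, Ideal.Quotient.eq_zero_iff_mem]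
        exact Ideal.mem_span_singleton_self _
    exact this
  unit := h.unit.map (Ideal.Quotient.mk (Ideal.span {φ c}))
  lift ψ h0 h1 := by
    obtain ⟨θ, hθ⟩ := h.lift ψ (fun x hx => h0 x (Ideal.mem_sup_left hx)) h1
    refine ⟨Ideal.Quotient.lift _ θ ?_, ?_⟩
    · have : Ideal.span {φ c} ≤ RingHom.ker θ := by
        rw [Ideal.span_singleton_le_iff_mem, RingHom.mem_ker, ← RingHom.comp_apply, hθ]
        exact h0 c (Ideal.mem_sup_right (Ideal.mem_span_singleton_self _))
      exact this
    · ext x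
      exact RingHom.congr_fun hθ x
  ext θ θ' hθ := Ideal.Quotient.ringHom_ext (h.ext _ _ hθ)

theorem away (h : IsPiece φ I g) (c : B) :
    IsPiece ((algebraMap C (Localization.Away (φ c))).comp φ) I (g * c) where
  zero x hx := by rw [RingHom.comp_apply, h.zero x hx, map_zero]
  unit := by
    rw [map_mul]
    exact (h.unit.map (algebraMap C (Localization.Away (φ c)))).mul (IsLocalization.Away.algebraMap_isUnit (φ c))
  lift ψ h0 h1 := by
    rw [map_mul, IsUnit.mul_iff] at h1
    obtain ⟨θ, hθ⟩ := h.lift ψ h0 h1.1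
    refine ⟨IsLocalization.Away.lift (g := θ) (φ c) ?_, ?_⟩
    · rw [← RingHom.comp_apply, hθ]
      exact h1.2
    · rw [← RingHom.comp_assoc, IsLocalization.Away.lift_comp, hθ]
  ext θ θ' hθ := IsLocalization.ringHom_ext (Submonoid.powers (φ c)) (h.ext _ _ hθ)

open Polynomial

theorem polynomial (h : IsPiece φ I g) :
    IsPiece (mapRingHom φ) (I.map (Polynomial.C : B →+* B[X])) (Polynomial.C g) where
  zero := by
    have : I.map (Polynomial.C : B →+* B[X]) ≤ RingHom.ker (mapRingHom φ) := by
      rw [Ideal.map_le_iff_le_comap]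
      intro x hx
      simp [h.zero x hx]
    exact this
  unit := by
    rw [coe_mapRingHom, map_C]
    exact h.unit.map Polynomial.C
  lift ψ h0 h1 := by
    obtain ⟨θ, hθ⟩ := h.lift (ψ.comp Polynomial.C) (fun x hx => h0 _ (Ideal.mem_map_of_mem _ hx)) h1
    refine ⟨eval₂RingHom θ (ψ X), ?_⟩
    refine Polynomial.ringHom_ext (fun a => ?_) (by simp)
    simpa using RingHom.congr_fun hθ a
  ext θ θ' hθ := by
    refine Polynomial.ringHom_ext' (h.ext _ _ ?_) ?_
    · ext b
      simpa using RingHom.congr_fun hθ (Polynomial.C b)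
    · simpa using RingHom.congr_fun hθ X

/-- On the piece a is invertible with inverse u, so aX + b = 0 is solved by X = -bu and the
coordinate ring does not change. -/
theorem linear (h : IsPiece φ I g) (a b : B) (u : C) (hu : φ a * u = 1) :
    IsPiece (eval₂RingHom φ (-(φ b) * u))
      (I.map Polynomial.C ⊔ Ideal.span {Polynomial.C a * X + Polynomial.C b}) (Polynomial.C g) where
  zero := by
    have : I.map Polynomial.C ⊔ Ideal.span {Polynomial.C a * X + Polynomial.C b} ≤
        RingHom.ker (eval₂RingHom φ (-(φ b) * u)) := by
      refine sup_le ?_ ((Ideal.span_singleton_le_iff_mem _).2 ?_)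
      · rw [Ideal.map_le_iff_le_comap]
        intro x hx
        simp [h.zero x hx]
      · rw [RingHom.mem_ker]
        simp
        linear_combination -(φ b) * hu
    exact this
  unit := by simpa using h.unit
  lift ψ h0 h1 := by
    obtain ⟨θ, hθ⟩ := h.lift (ψ.comp Polynomial.C)
      (fun x hx => h0 _ (Ideal.mem_sup_left (Ideal.mem_map_of_mem _ hx))) h1
    have hθ' (x : B) : θ (φ x) = ψ (Polynomial.C x) := RingHom.congr_fun hθ x
    refine ⟨θ, Polynomial.ringHom_ext (fun x => by simpa using hθ' x) ?_⟩
    have h2 := h0 _ (Ideal.mem_sup_right (Ideal.mem_span_singleton_self _))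
    rw [map_add, map_mul, ← hθ', ← hθ'] at h2
    have h3 : θ (φ a) * θ u = 1 := by rw [← map_mul, hu, map_one]
    simp
    linear_combination (ψ X) * h3 - θ u * h2
  ext θ θ' hθ := h.ext _ _ (by
    ext x
    simpa using RingHom.congr_fun hθ (Polynomial.C x))

end IsPiece

variable (K : Type u) [Field K]
variable {B : Type u} [CommRing B] [Algebra K B] [Algebra.FiniteType K B]

/-- The class of the locally closed subvariety `V(I) ∩ D(g)` of `Spec B`. -/
def pieceClass (I : Ideal B) (g : B) : GrothendieckRing K :=
  affineClass K (Localization.Away (Ideal.Quotient.mk I g))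

variable {K}

theorem IsPiece.pieceClass_eq {C : Type u} [CommRing C] [Algebra K C] [Algebra.FiniteType K C]
    {φ : B →ₐ[K] C} {I : Ideal B} {g : B} (h : IsPiece (φ : B →+* C) I g) :
    pieceClass K I g = affineClass K C :=
  affineClass_congr (IsPiece.exists_algEquiv
    (φ := IsScalarTower.toAlgHom K B (Localization.Away (Ideal.Quotient.mk I g)))
    (IsPiece.of_localization I g) h).some

theorem pieceClass_congr_algEquiv {B' : Type u} [CommRing B'] [Algebra K B']
    [Algebra.FiniteType K B'] (e : B ≃ₐ[K] B') (I : Ideal B) (g : B) :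
    pieceClass K (I.map e) (e g) = pieceClass K I g := by
  have h := IsPiece.of_localization I g
  refine IsPiece.pieceClass_eq (φ := (IsScalarTower.toAlgHom K B
    (Localization.Away (Ideal.Quotient.mk I g))).comp (e.symm : B' →ₐ[K] B))
    ⟨?_, ?_, ?_, ?_⟩
  · have : I.map e ≤ RingHom.ker (((IsScalarTower.toAlgHom K B
      (Localization.Away (Ideal.Quotient.mk I g))).comp (e.symm : B' →ₐ[K] B)) : B' →ₐ[K] _) := by
      rw [Ideal.map_le_iff_le_comap]
      intro x hx
      simpa using h.zero x hx
    exact this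
  · simpa using h.unit
  · intro S _ ψ h0 h1
    obtain ⟨θ, hθ⟩ := h.lift (ψ.comp (e : B →+* B'))
      (fun x hx => h0 _ (Ideal.mem_map_of_mem _ hx)) h1
    refine ⟨θ, RingHom.ext fun x => ?_⟩
    simpa using RingHom.congr_fun hθ (e.symm x)
  · intro S _ θ θ' hθ
    refine h.ext _ _ (RingHom.ext fun x => ?_)
    simpa using RingHom.congr_fun hθ (e x)

theorem pieceClass_bot_one : pieceClass K (⊥ : Ideal B) 1 = affineClass K B := by
  refine IsPiece.pieceClass_eq (φ := AlgHom.id K B) ⟨?_, ?_, ?_, ?_⟩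
  · simp
  · simp
  · exact fun ψ _ _ => ⟨ψ, rfl⟩
  · exact fun _ _ h => h

theorem pieceClass_bot (g : B) : pieceClass K ⊥ g = affineClass K (Localization.Away g) := by
  refine IsPiece.pieceClass_eq (φ := IsScalarTower.toAlgHom K B (Localization.Away g)) ⟨?_, ?_, ?_, ?_⟩
  · simp
  · exact IsLocalization.Away.algebraMap_isUnit _
  · exact fun ψ _ h => ⟨IsLocalization.Away.lift g h, IsLocalization.Away.lift_comp g h⟩
  · exact fun _ _ h => IsLocalization.ringHom_ext (Submonoid.powers g) h

theorem pieceClass_cut (I : Ideal B) (g c : B) :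
    pieceClass K I g = pieceClass K (I ⊔ Ideal.span {c}) g + pieceClass K I (g * c) := by
  have h := IsPiece.of_localization I g
  conv_lhs => rw [pieceClass]
  rw [affineClass_cut (algebraMap B (Localization.Away (Ideal.Quotient.mk I g)) c)]
  congr 1
  · exact (IsPiece.pieceClass_eq (φ := (Ideal.Quotient.mkₐ K _).comp
      (IsScalarTower.toAlgHom K B (Localization.Away (Ideal.Quotient.mk I g)))) (h.quotient c)).symm
  · exact (IsPiece.pieceClass_eq (φ := (IsScalarTower.toAlgHom K _ _).comp
      (IsScalarTower.toAlgHom K B (Localization.Away (Ideal.Quotient.mk I g)))) (h.away c)).symm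

theorem pieceClass_eq_zero {I : Ideal B} {g : B}
    (h : ∀ p : Ideal B, p.IsPrime → I ≤ p → g ∈ p) : pieceClass K I g = 0 := by
  have h1 : g ∈ I.radical := by
    rw [Ideal.radical_eq_sInf, Submodule.mem_sInf]
    exact fun p hp => h p hp.2 hp.1
  obtain ⟨n, hn⟩ := h1
  have : Subsingleton (Localization.Away (Ideal.Quotient.mk I g)) := by
    have h2 := IsPiece.of_localization I g
    have h3 := h2.unit.pow n
    rw [← map_pow, h2.zero _ hn] at h3
    exact isUnit_zero_iff.1 h3 |> fun h => subsingleton_of_zero_eq_one h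
  exact affineClass_of_subsingleton

/-- The class sees only the points of a piece, not its scheme structure: cutting along a function
that vanishes at every point of the piece splits off an empty piece. This reduces later comparisons
of loci to propositional logic at each prime. -/
theorem pieceClass_ext {I J : Ideal B} {g h : B}
    (H : ∀ p : Ideal B, p.IsPrime → ((I ≤ p ∧ g ∉ p) ↔ (J ≤ p ∧ h ∉ p))) :
    pieceClass K I g = pieceClass K J h := by
  have : IsNoetherianRing B := Algebra.FiniteType.isNoetherianRing K B
  -- Both loci are compared with their intersection V(I + J) ∩ D(gh).
  have key (I J : Ideal B) (g h : B)
      (H : ∀ p : Ideal B, p.IsPrime → I ≤ p → g ∉ p → (J ≤ p ∧ h ∉ p)) :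
      pieceClass K I g = pieceClass K (I ⊔ J) (g * h) := by
    have h1 : pieceClass K I g = pieceClass K (I ⊔ J) g := by
      have H' (p : Ideal B) (hp : p.IsPrime) (h1 : I ≤ p) (h2 : g ∉ p) := (H p hp h1 h2).1
      clear H
      classical
      -- The generators of J are imposed one at a time, each cut removing an empty piece.
      obtain ⟨s, rfl⟩ := IsNoetherian.noetherian J
      induction s using Finset.induction_on with
      | empty => simp
      | insert c s _ ih =>
        rw [Finset.coe_insert, Submodule.span_insert] at H' ⊢
        rw [ih fun p hp h1 h2 => le_sup_right.trans (H' p hp h1 h2),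
          pieceClass_cut _ g c, pieceClass_eq_zero (g := g * c), add_zero, sup_comm (Submodule.span _ _),
          sup_assoc]
        intro p hp h1
        by_cases h2 : g ∈ p
        · exact p.mul_mem_right _ h2
        · exact p.mul_mem_left _ (H' p hp (le_sup_left.trans h1) h2
            (Submodule.mem_sup_left (Submodule.mem_span_singleton_self c)))
    rw [h1, pieceClass_cut _ g h, pieceClass_eq_zero (g := g), zero_add]
    intro p hp h2
    by_contra h3
    exact (H p hp (le_sup_left.trans (le_sup_left.trans h2)) h3).2
      (h2 (Ideal.mem_sup_right (Ideal.mem_span_singleton_self h)))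
  rw [key I J g h fun p hp h1 h2 => (H p hp).1 ⟨h1, h2⟩,
    key J I h g fun p hp h1 h2 => (H p hp).2 ⟨h1, h2⟩, sup_comm, mul_comm]

theorem pieceClass_eq_add {I J J' : Ideal B} {g h h' : B} (c : B)
    (H : ∀ p : Ideal B, p.IsPrime → c ∈ p → ((I ≤ p ∧ g ∉ p) ↔ (J ≤ p ∧ h ∉ p)))
    (hJ : ∀ p : Ideal B, p.IsPrime → J ≤ p → h ∉ p → c ∈ p)
    (H' : ∀ p : Ideal B, p.IsPrime → c ∉ p → ((I ≤ p ∧ g ∉ p) ↔ (J' ≤ p ∧ h' ∉ p)))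
    (hJ' : ∀ p : Ideal B, p.IsPrime → J' ≤ p → h' ∉ p → c ∉ p) :
    pieceClass K I g = pieceClass K J h + pieceClass K J' h' := by
  rw [pieceClass_cut I g c]
  congr 1
  · refine pieceClass_ext fun p hp => ?_
    rw [sup_le_iff, Ideal.span_singleton_le_iff_mem]
    have := H p hp
    have := hJ p hp
    tauto
  · refine pieceClass_ext fun p hp => ?_
    rw [hp.mul_mem_iff_mem_or_mem]
    have := H' p hp
    have := hJ' p hp
    tauto

open Polynomial

theorem pieceClass_polynomial (I : Ideal B) (g : B) :
    pieceClass K (I.map (C : B →+* B[X])) (C g) = (torusClass K + 1) * pieceClass K I g := by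
  rw [IsPiece.pieceClass_eq (φ := Polynomial.mapAlgHom
    (IsScalarTower.toAlgHom K B (Localization.Away (Ideal.Quotient.mk I g))))
    (IsPiece.of_localization I g).polynomial, affineClass_polynomial, affineClass_polynomial_self,
    mul_comm]
  rfl

/-- Since a vanishes nowhere on the piece, the locus is the graph of the function -b/a over it. -/
theorem pieceClass_linear (I : Ideal B) (g a b : B)
    (h : ∀ p : Ideal B, p.IsPrime → I ≤ p → g ∉ p → a ∉ p) :
    pieceClass K (I.map (C : B →+* B[X]) ⊔ Ideal.span {C a * X + C b}) (C g) =
      pieceClass K I g := by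
  have h0 := IsPiece.of_localization I g
  set φ := IsScalarTower.toAlgHom K B (Localization.Away (Ideal.Quotient.mk I g)) with hφ
  have hu : IsUnit (φ a) := by
    -- A maximal ideal containing the image of a would contract to a point of the piece at which a
    -- vanishes.
    by_contra hu
    obtain ⟨M, hM, ha⟩ := exists_max_ideal_of_mem_nonunits hu
    refine h (M.comap (φ : B →+* Localization.Away (Ideal.Quotient.mk I g))) (Ideal.IsPrime.comap _) (fun x hx => ?_) (fun hg => ?_) ha
    · rw [Ideal.mem_comap]
      exact (h0.zero x hx).symm ▸ M.zero_mem
    · exact hM.ne_top (Ideal.eq_top_of_isUnit_mem _ hg h0.unit)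
  obtain ⟨u, hu⟩ := hu.exists_right_inv
  exact IsPiece.pieceClass_eq (φ := Polynomial.eval₂AlgHom φ (-(φ b) * u) fun _ => .all _ _)
    (h0.linear a b u hu)

end Pieces

/-! ### The state of a pair of functions under parallel and series extension -/

section PairState

variable (K : Type u) [Field K]
variable {B : Type u} [CommRing B] [Algebra K B] [Algebra.FiniteType K B]

/-- The classes of the loci `{a ≠ 0, b ≠ 0}`, `{a ≠ 0, b = 0}` and `{a = 0, b ≠ 0}`. -/
def pairState (a b : B) : GrothendieckRing K × GrothendieckRing K × GrothendieckRing K :=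
  (pieceClass K ⊥ (a * b), pieceClass K (Ideal.span {b}) a, pieceClass K (Ideal.span {a}) b)

/-- The effect on `pairState` of replacing `(a, b)` by `(a z + b, b z)`. -/
def parallelStep {R : Type*} [CommRing R] (T : R) (s : R × R × R) : R × R × R :=
  ((T - 1) * s.1 + T * s.2.2, s.1 + T * s.2.1 + s.2.2, s.1)

/-- The effect on `pairState` of replacing `(a, b)` by `(a, b + a z)`. -/
def seriesStep {R : Type*} [CommRing R] (T : R) (s : R × R × R) : R × R × R :=
  (T * (s.1 + s.2.1), s.1 + s.2.1, (T + 1) * s.2.2)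

/-- Two series steps followed by `v - 2` parallel steps. -/
def stringStep {R : Type*} [CommRing R] (v : ℕ) (T : R) (s : R × R × R) : R × R × R :=
  (parallelStep T)^[v - 2] (seriesStep T (seriesStep T s))

variable {K}

theorem pairState_algEquiv {B' : Type u} [CommRing B'] [Algebra K B'] [Algebra.FiniteType K B']
    (e : B ≃ₐ[K] B') (a b : B) : pairState K (e a) (e b) = pairState K a b := by
  have h (x : B) : Ideal.span {e x} = (Ideal.span {x}).map e := by
    rw [Ideal.map_span, Set.image_singleton]
  have h' : (⊥ : Ideal B') = (⊥ : Ideal B).map e := (Ideal.map_bot).symm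
  simp only [pairState, h, ← map_mul, pieceClass_congr_algEquiv]
  rw [h', pieceClass_congr_algEquiv]

theorem affineClass_away_eq (a b : B) :
    affineClass K (Localization.Away a) = (pairState K a b).1 + (pairState K a b).2.1 := by
  rw [← pieceClass_bot, pieceClass_cut ⊥ a b, bot_sup_eq, add_comm]
  rfl

open Polynomial

/-- The trivial line bundle over the piece, minus its zero section. -/
theorem pieceClass_polynomial_mul_X (I : Ideal B) (g : B) :
    pieceClass K (I.map (C : B →+* B[X])) (C g * X) = torusClass K * pieceClass K I g := by
  have h := pieceClass_cut (K := K) (I.map (C : B →+* B[X])) (C g) X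
  have h' := pieceClass_linear (K := K) I g 1 0
    (fun p hp _ _ h => hp.ne_top ((Ideal.eq_top_iff_one p).2 h))
  rw [C_1, C_0, one_mul, add_zero] at h'
  rw [pieceClass_polynomial, h'] at h
  linear_combination -h

theorem map_C_span_singleton (a : B) :
    (Ideal.span {a}).map (C : B →+* B[X]) = Ideal.span {C a} := by
  rw [Ideal.map_span, Set.image_singleton]

theorem pieceClass_linear_span (g a b : B)
    (h : ∀ p : Ideal B, p.IsPrime → g ∉ p → a ∉ p) :
    pieceClass K (Ideal.span {C a * X + C b}) (C g : B[X]) = pieceClass K ⊥ g := by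
  have h := pieceClass_linear (K := K) ⊥ g a b (fun p hp _ => h p hp)
  rwa [Ideal.map_bot, bot_sup_eq] at h

theorem pieceClass_X_span (g : B) :
    pieceClass K (Ideal.span {X}) (C g : B[X]) = pieceClass K ⊥ g := by
  have h := pieceClass_linear_span (K := K) g 1 0
    (fun p hp _ h => hp.ne_top ((Ideal.eq_top_iff_one p).2 h))
  rwa [C_1, C_0, one_mul, add_zero] at h

theorem pieceClass_bot_eq (a b : B) :
    pieceClass K ⊥ a = pieceClass K (Ideal.span {b}) a + pieceClass K ⊥ (a * b) := by
  rw [pieceClass_cut ⊥ a b, bot_sup_eq]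

/-- These are the only arithmetic facts at a point that `tauto` needs in the comparisons of loci
below. -/
theorem Ideal.IsPrime.linear_mem_iff {p : Ideal B[X]} (hp : p.IsPrime) (a b : B) :
    (C a ∈ p → (C a * X + C b ∈ p ↔ C b ∈ p)) ∧
      (X ∈ p → (C a * X + C b ∈ p ↔ C b ∈ p)) ∧
      (C b ∈ p → (C a * X + C b ∈ p ↔ C a ∈ p ∨ X ∈ p)) := by
  refine ⟨fun h => ?_, fun h => ?_, fun h => ?_⟩
  · exact Ideal.add_mem_iff_right _ (p.mul_mem_right _ h)
  · exact Ideal.add_mem_iff_right _ (p.mul_mem_left _ h)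
  · rw [Ideal.add_mem_iff_left _ h, hp.mul_mem_iff_mem_or_mem]

theorem pairState_parallel (a b : B) :
    pairState K (C a * X + C b : B[X]) (C b * X) = parallelStep (torusClass K) (pairState K a b) := by
  have hlin (p : Ideal B[X]) (hp : p.IsPrime) := hp.linear_mem_iff a b
  have hab : pieceClass K (Ideal.span {C a * X + C b}) (C (a * b) : B[X]) =
      pieceClass K ⊥ (a * b) :=
    pieceClass_linear_span _ _ _ fun p _ h1 h2 => h1 (p.mul_mem_right _ h2)
  refine Prod.ext ?_ (Prod.ext ?_ ?_) <;> simp only [pairState, parallelStep]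
  -- Where a = 0, the condition is bz ≠ 0, giving T copies of {a = 0, b ≠ 0}. Where a ≠ 0, the
  -- coordinate z avoids the two distinct values 0 and -b/a, giving T - 1 copies of {ab ≠ 0}.
  · have h1 : pieceClass K ⊥ ((C a * X + C b) * (C b * X)) =
        pieceClass K (Ideal.span {C a}) (C b * X) +
          pieceClass K ⊥ (C (a * b) * X * (C a * X + C b)) := by
      refine pieceClass_eq_add (C a) ?_ ?_ ?_ ?_ <;> intro p hp <;>
        simp only [Ideal.span_singleton_le_iff_mem, map_mul, hp.mul_mem_iff_mem_or_mem, not_or,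
          bot_le] <;> have := hlin p hp <;> tauto
    have h2 : pieceClass K ⊥ (C (a * b) * X) = pieceClass K (Ideal.span {C a * X + C b}) (C (a * b))
        + pieceClass K ⊥ (C (a * b) * X * (C a * X + C b)) := by
      refine pieceClass_eq_add (C a * X + C b) ?_ ?_ ?_ ?_ <;> intro p hp <;>
        simp only [Ideal.span_singleton_le_iff_mem, map_mul, hp.mul_mem_iff_mem_or_mem, not_or,
          bot_le] <;> have := hlin p hp <;> tauto
    have h3 := pieceClass_polynomial_mul_X (K := K) ⊥ (a * b)
    have h4 := pieceClass_polynomial_mul_X (K := K) (Ideal.span {a}) b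
    rw [Ideal.map_bot] at h3
    rw [map_C_span_singleton] at h4
    linear_combination h1 - h2 + h3 + h4 - hab
  -- Either b = 0 and az ≠ 0, or b ≠ 0 and z = 0 with a arbitrary.
  · have h1 : pieceClass K (Ideal.span {C b * X}) (C a * X + C b) =
        pieceClass K (Ideal.span {C b}) (C a * X) + pieceClass K (Ideal.span {X}) (C b) := by
      refine pieceClass_eq_add (C b) ?_ ?_ ?_ ?_ <;> intro p hp <;>
        simp only [Ideal.span_singleton_le_iff_mem, hp.mul_mem_iff_mem_or_mem, not_or] <;>
        have := hlin p hp <;> tauto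
    have h2 := pieceClass_polynomial_mul_X (K := K) (Ideal.span {b}) a
    rw [map_C_span_singleton] at h2
    have h3 := pieceClass_bot_eq (K := K) b a
    rw [mul_comm b a] at h3
    linear_combination h1 + h2 + h3 + pieceClass_X_span (K := K) b
  · rw [← hab]
    refine pieceClass_ext fun p hp => ?_
    simp only [Ideal.span_singleton_le_iff_mem, map_mul, hp.mul_mem_iff_mem_or_mem, not_or]
    have := hlin p hp
    tauto

theorem pairState_series (a b : B) :
    pairState K (C a : B[X]) (C a * X + C b) = seriesStep (torusClass K) (pairState K a b) := by
  have ha : pieceClass K (Ideal.span {C a * X + C b}) (C a : B[X]) = pieceClass K ⊥ a :=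
    pieceClass_linear_span _ _ _ fun _ _ h => h
  have hb := pieceClass_bot_eq (K := K) a b
  refine Prod.ext ?_ (Prod.ext ?_ ?_) <;> simp only [pairState, seriesStep]
  -- Over {a ≠ 0}, the whole line minus the graph of -b/a leaves T.
  · have h1 := pieceClass_bot_eq (K := K) (C a) (C a * X + C b)
    have h2 := pieceClass_polynomial (K := K) ⊥ a
    rw [Ideal.map_bot] at h2
    linear_combination h2 - h1 - ha + torusClass K * hb
  · linear_combination ha + hb
  · rw [← pieceClass_polynomial, map_C_span_singleton]
    refine pieceClass_ext fun p hp => ?_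
    simp only [Ideal.span_singleton_le_iff_mem]
    have := hp.linear_mem_iff a b
    tauto

end PairState

/-! ### Generating polynomials of minimal edge sets, and their states -/

section EdgeSets

variable (K : Type u) [Field K]

open Classical in
/-- The sum `∑_S ∏_{e ∉ S} t_e` over the sets `S` satisfying `p`. -/
def complementSum {σ : Type} [Fintype σ] (p : Set σ → Prop) : MvPolynomial σ K :=
  ∑ S : Finset σ, if p (S : Set σ) then ∏ e ∈ Finset.univ \ S, MvPolynomial.X e else 0

variable {K} {σ τ : Type} [Fintype σ] [Fintype τ]

theorem complementSum_false : complementSum K (fun _ : Set σ => False) = 0 := by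
  simp [complementSum]

theorem complementSum_eq [DecidableEq σ] (p : Set σ → Prop) [∀ S, Decidable (p S)] :
    complementSum K p = ∑ S : Finset σ,
      if p (S : Set σ) then ∏ e ∈ Finset.univ \ S, MvPolynomial.X e else 0 := by
  unfold complementSum
  refine Finset.sum_congr rfl fun S _ => ?_
  split_ifs
  · exact Finset.prod_congr (by ext; simp) fun _ _ => rfl
  · rfl

theorem complementSum_congr {p q : Set σ → Prop} (h : ∀ S, p S ↔ q S) :
    complementSum K p = complementSum K q := by
  rw [funext fun S => propext (h S)]

theorem renameEquiv_complementSum (e : σ ≃ τ) (p : Set σ → Prop) :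
    MvPolynomial.renameEquiv K e (complementSum K p) = complementSum K fun S => p (e ⁻¹' S) := by
  classical
  simp only [complementSum_eq, map_sum]
  refine Fintype.sum_equiv (Equiv.finsetCongr e) _ _ fun S => ?_
  have h : (e ⁻¹' ((Equiv.finsetCongr e S : Finset τ) : Set τ)) = S := by
    ext x; simp
  simp only [h]
  split_ifs
  · rw [map_prod]
    refine Finset.prod_equiv e (fun x => ?_) (fun x _ => by simp)
    simp
  · simp

theorem optionEquivLeft_complementSum (p : Set (Option σ) → Prop) :
    MvPolynomial.optionEquivLeft K σ (complementSum K p) =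
      Polynomial.C (complementSum K fun S => p (some '' S)) * Polynomial.X +
        Polynomial.C (complementSum K fun S => p (insert none (some '' S))) := by
  classical
  have h (f : Finset (Option σ) → Polynomial (MvPolynomial σ K)) :
      ∑ S, f S = ∑ S : Finset σ, f (S.map .some) +
        ∑ S : Finset σ, f (insert none (S.map .some)) := by
    have h1 : (Finset.univ : Finset (Finset (Option σ))) =
        (insert none ((Finset.univ : Finset σ).map .some)).powerset := by
      rw [← Finset.powerset_univ]
      congr 1
      ext x; cases x <;> simp
    rw [h1, Finset.sum_powerset_insert (by simp)]
    have h2 : ((Finset.univ : Finset σ).map .some).powerset =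
        (Finset.univ : Finset (Finset σ)).map (Finset.mapEmbedding .some).toEmbedding := by
      ext T
      simp [Finset.subset_map_iff, eq_comm]
    rw [h2, Finset.sum_map, Finset.sum_map]
    rfl
  simp only [complementSum_eq, map_sum, h, Finset.sum_mul]
  congr 1 <;> refine Finset.sum_congr rfl fun S _ => ?_
  · rw [Finset.coe_map, Function.Embedding.some_apply]
    split_ifs
    · have : Finset.univ \ S.map .some = insert none ((Finset.univ \ S).map .some) := by
        ext x; cases x <;> simp
      rw [this, Finset.prod_insert (by simp), Finset.prod_map, map_mul, map_prod, map_prod, mul_comm]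
      simp
    · simp
  · rw [Finset.coe_insert, Finset.coe_map, Function.Embedding.some_apply]
    split_ifs
    · have : Finset.univ \ insert none (S.map .some) = (Finset.univ \ S).map .some := by
        ext x; cases x <;> simp
      rw [this, Finset.prod_map, map_prod, map_prod]
      simp
    · simp

/-- `S` satisfies `c`, but ceases to do so when any element is removed. -/
def IsMinimalFor (c : Set σ → Prop) (S : Set σ) : Prop :=
  c S ∧ ∀ f ∈ S, ¬ c (S \ {f})

variable (K) in
/-- Let `c₀` and `c₁` say which sets of the other edges of a graph connect it without, respectively
together with, a given edge `e`. This is the state of the pair `(Ψ_{G∖e}, Ψ_{G/e})`. -/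
def edgeState (c₀ c₁ : Set σ → Prop) :
    GrothendieckRing K × GrothendieckRing K × GrothendieckRing K :=
  pairState K (complementSum K (IsMinimalFor c₀))
    (complementSum K fun S => ¬ c₀ S ∧ IsMinimalFor c₁ S)

theorem edgeState_congr {c₀ c₁ d₀ d₁ : Set σ → Prop} (h₀ : ∀ S, c₀ S ↔ d₀ S)
    (h₁ : ∀ S, c₁ S ↔ d₁ S) : edgeState K c₀ c₁ = edgeState K d₀ d₁ := by
  rw [funext fun S => propext (h₀ S), funext fun S => propext (h₁ S)]

omit [Fintype σ] [Fintype τ] in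
theorem isMinimalFor_preimage (e : σ ≃ τ) (c : Set σ → Prop) (S : Set τ) :
    IsMinimalFor (fun S => c (e ⁻¹' S)) S ↔ IsMinimalFor c (e ⁻¹' S) := by
  unfold IsMinimalFor
  refine and_congr_right fun _ => ?_
  rw [← e.forall_congr_right (q := fun f => f ∈ S → ¬ c (e ⁻¹' (S \ {f})))]
  refine forall_congr' fun x => ?_
  have : e ⁻¹' (S \ {e x}) = e ⁻¹' S \ {x} := by
    ext y; simp
  rw [this, Set.mem_preimage]

theorem edgeState_equiv (e : σ ≃ τ) (c₀ c₁ : Set σ → Prop) :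
    edgeState K (fun S => c₀ (e ⁻¹' S)) (fun S => c₁ (e ⁻¹' S)) = edgeState K c₀ c₁ := by
  unfold edgeState
  rw [← pairState_algEquiv (MvPolynomial.renameEquiv K e), renameEquiv_complementSum,
    renameEquiv_complementSum]
  congr 1 <;> refine complementSum_congr fun S => ?_ <;> rw [isMinimalFor_preimage]

omit [Fintype σ] in
theorem isMinimalFor_image_some (c : Set (Option σ) → Prop) (S : Set σ) :
    IsMinimalFor c (some '' S) ↔ IsMinimalFor (fun S => c (some '' S)) S := by
  unfold IsMinimalFor
  rw [Set.forall_mem_image]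
  have (x : σ) : some '' S \ {some x} = some '' (S \ {x}) := by
    rw [Set.image_sdiff (Option.some_injective σ), Set.image_singleton]
  simp only [this]

omit [Fintype σ] in
-- Removing `none` must destroy the property, which is the first condition; removing any other
-- element keeps `none` and gives the second. With `isMinimalFor_image_some` this is the
-- deletion–contraction formula, phrased without forming the deleted or contracted graph.
theorem isMinimalFor_insert_none (c : Set (Option σ) → Prop) (S : Set σ) :
    IsMinimalFor c (insert none (some '' S)) ↔
      ¬ c (some '' S) ∧ IsMinimalFor (fun S => c (insert none (some '' S))) S := by
  unfold IsMinimalFor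
  rw [Set.forall_mem_insert, Set.forall_mem_image]
  have h (x : σ) : insert none (some '' S) \ {some x} = insert none (some '' (S \ {x})) := by
    rw [Set.image_sdiff (Option.some_injective σ), Set.image_singleton]
    ext y; cases y <;> simp
  have h' : insert none (some '' S) \ {none} = some '' S := by
    ext y; cases y <;> simp
  simp only [h, h']
  tauto

theorem optionEquivLeft_complementSum_isMinimalFor (c : Set (Option σ) → Prop) :
    MvPolynomial.optionEquivLeft K σ (complementSum K (IsMinimalFor c)) =
      Polynomial.C (complementSum K (IsMinimalFor fun S => c (some '' S))) * Polynomial.X +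
        Polynomial.C (complementSum K fun S => ¬ c (some '' S) ∧
          IsMinimalFor (fun S => c (insert none (some '' S))) S) := by
  rw [optionEquivLeft_complementSum, complementSum_congr (isMinimalFor_image_some c),
    complementSum_congr (isMinimalFor_insert_none c)]

theorem affineClass_complementSum {c : Set (Option σ) → Prop} {c₀ c₁ : Set σ → Prop}
    (h₀ : ∀ S, c (some '' S) ↔ c₀ S) (h₁ : ∀ S, c (insert none (some '' S)) ↔ c₁ S) :
    affineClass K (Localization.Away (complementSum K (IsMinimalFor c))) =
      torusClass K * ((edgeState K c₀ c₁).1 + (edgeState K c₀ c₁).2.1) +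
        (torusClass K + 1) * (edgeState K c₀ c₁).2.2 := by
  obtain rfl : (fun S => c (some '' S)) = c₀ := funext fun S => propext (h₀ S)
  obtain rfl : (fun S => c (insert none (some '' S))) = c₁ := funext fun S => propext (h₁ S)
  -- The first two entries of a state add up to the class of {first function ≠ 0} whatever the
  -- second function is. Choosing bX as the second makes the pair the one treated by
  -- `pairState_parallel`.
  rw [affineClass_away_eq _ ((MvPolynomial.optionEquivLeft K σ).symm (Polynomial.C (complementSum K
      fun S => ¬ c (some '' S) ∧ IsMinimalFor (fun S => c (insert none (some '' S))) S) *
        Polynomial.X)), ← pairState_algEquiv (MvPolynomial.optionEquivLeft K σ),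
    optionEquivLeft_complementSum_isMinimalFor, AlgEquiv.apply_symm_apply, pairState_parallel]
  simp only [edgeState, parallelStep]
  ring

/-- Here `none` is a new edge z parallel to e: when e is absent z takes over its role, and when e is
present z makes no difference. -/
theorem edgeState_parallel (c₀ c₁ : Set σ → Prop) :
    edgeState K (fun S : Set (Option σ) => (none ∈ S → c₁ (some ⁻¹' S)) ∧
        (none ∉ S → c₀ (some ⁻¹' S))) (fun S => c₁ (some ⁻¹' S)) =
      parallelStep (torusClass K) (edgeState K c₀ c₁) := by
  have h (S : Set σ) : some ⁻¹' (insert none (some '' S)) = S := by ext; simp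
  have h' (S : Set σ) : some ⁻¹' (some '' S) = S := by ext; simp
  let E := MvPolynomial.optionEquivLeft K σ
  have hF : E (complementSum K (IsMinimalFor fun S : Set (Option σ) =>
      (none ∈ S → c₁ (some ⁻¹' S)) ∧ (none ∉ S → c₀ (some ⁻¹' S)))) =
      Polynomial.C (complementSum K (IsMinimalFor c₀)) * Polynomial.X +
        Polynomial.C (complementSum K fun S => ¬ c₀ S ∧ IsMinimalFor c₁ S) := by
    rw [optionEquivLeft_complementSum_isMinimalFor]
    simp [h, h']
  have hH : E (complementSum K fun S : Set (Option σ) =>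
      ¬ ((none ∈ S → c₁ (some ⁻¹' S)) ∧ (none ∉ S → c₀ (some ⁻¹' S))) ∧
        IsMinimalFor (fun S => c₁ (some ⁻¹' S)) S) =
      Polynomial.C (complementSum K fun S => ¬ c₀ S ∧ IsMinimalFor c₁ S) * Polynomial.X := by
    -- After contracting e the edge z is a loop, so no minimal set contains it and the term without
    -- the factor z vanishes.
    rw [optionEquivLeft_complementSum, complementSum_congr
      (p := fun S => ¬ ((none ∈ insert none (some '' S) → _) ∧ _) ∧ _) (q := fun _ => False),
      complementSum_false, map_zero, add_zero]
    · simp [h', isMinimalFor_image_some]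
    · intro S
      simp only [Set.mem_insert_iff, true_or, h, h', isMinimalFor_insert_none]
      exact iff_false_intro fun h1 => h1.2.1 h1.2.2.1
  unfold edgeState
  rw [← pairState_parallel, ← pairState_algEquiv E, hF, hH]

/-- Here `none` is a new edge z in series with e: when e is absent z is needed to reach the
subdividing vertex but joins nothing else, and when e is present z plays the former role of e. -/
theorem edgeState_series (c₀ c₁ : Set σ → Prop) :
    edgeState K (fun S : Set (Option σ) => none ∈ S ∧ c₀ (some ⁻¹' S))
        (fun S => (none ∈ S → c₁ (some ⁻¹' S)) ∧ (none ∉ S → c₀ (some ⁻¹' S))) =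
      seriesStep (torusClass K) (edgeState K c₀ c₁) := by
  have h (S : Set σ) : some ⁻¹' (insert none (some '' S)) = S := by ext; simp
  have h' (S : Set σ) : some ⁻¹' (some '' S) = S := by ext; simp
  let E := MvPolynomial.optionEquivLeft K σ
  have h0 : IsMinimalFor (fun _ : Set σ => False) = fun _ => False := by
    ext; simp [IsMinimalFor]
  have hF : E (complementSum K (IsMinimalFor fun S : Set (Option σ) =>
      none ∈ S ∧ c₀ (some ⁻¹' S))) = Polynomial.C (complementSum K (IsMinimalFor c₀)) := by
    rw [optionEquivLeft_complementSum_isMinimalFor]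
    simp [h, h', h0, complementSum_false]
  have hH : E (complementSum K fun S : Set (Option σ) => ¬ (none ∈ S ∧ c₀ (some ⁻¹' S)) ∧
      IsMinimalFor (fun S => (none ∈ S → c₁ (some ⁻¹' S)) ∧ (none ∉ S → c₀ (some ⁻¹' S))) S) =
      Polynomial.C (complementSum K (IsMinimalFor c₀)) * Polynomial.X +
        Polynomial.C (complementSum K fun S => ¬ c₀ S ∧ IsMinimalFor c₁ S) := by
    rw [optionEquivLeft_complementSum]
    simp [h, h', isMinimalFor_image_some, isMinimalFor_insert_none]
  unfold edgeState
  rw [← pairState_series, ← pairState_algEquiv E, hF, hH]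

theorem edgeState_parallel_iterate (ρ : Type) [Fintype ρ] (c₀ c₁ : Set σ → Prop) :
    edgeState K (fun S : Set (σ ⊕ ρ) => ((∃ r, Sum.inr r ∈ S) → c₁ (Sum.inl ⁻¹' S)) ∧
        ((¬ ∃ r, Sum.inr r ∈ S) → c₀ (Sum.inl ⁻¹' S))) (fun S => c₁ (Sum.inl ⁻¹' S)) =
      (parallelStep (torusClass K))^[Fintype.card ρ] (edgeState K c₀ c₁) := by
  revert c₀ c₁
  refine Fintype.induction_empty_option (P := fun ρ _ => ∀ c₀ c₁ : Set σ → Prop,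
    edgeState K (fun S : Set (σ ⊕ ρ) => ((∃ r, Sum.inr r ∈ S) → c₁ (Sum.inl ⁻¹' S)) ∧
        ((¬ ∃ r, Sum.inr r ∈ S) → c₀ (Sum.inl ⁻¹' S))) (fun S => c₁ (Sum.inl ⁻¹' S)) =
      (parallelStep (torusClass K))^[Fintype.card ρ] (edgeState K c₀ c₁)) ?_ ?_ ?_ ρ
  · intro α β _ e ih c₀ c₁
    let := Fintype.ofEquiv β e.symm
    rw [← Fintype.card_congr e, ← ih, ← edgeState_equiv (Equiv.sumCongr (Equiv.refl σ) e)]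
    refine edgeState_congr (fun S => ?_) (fun S => Iff.rfl)
    have : (∃ r, Sum.inr r ∈ S) ↔ ∃ r, Sum.inr (e r) ∈ S :=
      (e.exists_congr_right (q := fun r => Sum.inr r ∈ S)).symm
    rw [this]
    rfl
  · intro c₀ c₁
    rw [Fintype.card_eq_zero, Function.iterate_zero, id,
      ← edgeState_equiv (Equiv.sumEmpty σ PEmpty).symm]
    refine edgeState_congr (fun S => ?_) (fun S => Iff.rfl)
    simp
    rfl
  · intro α _ ih c₀ c₁
    let e : Option (σ ⊕ α) ≃ σ ⊕ Option α :=
      ⟨fun x => x.elim (.inr none) (Sum.map id some),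
        Sum.elim (some ∘ .inl) (fun x => x.map .inr), fun x => by rcases x with _ | _ | _ <;> rfl,
        fun x => by rcases x with _ | _ | _ <;> rfl⟩
    rw [Fintype.card_option, Function.iterate_succ_apply', ← ih, ← edgeState_parallel,
      ← edgeState_equiv e]
    refine edgeState_congr (fun S => ?_) (fun S => Iff.rfl)
    rw [Option.exists]
    change _ ↔ (Sum.inr none ∈ S → c₁ (Sum.inl ⁻¹' S)) ∧ (Sum.inr none ∉ S →
      (((∃ r, Sum.inr (some r) ∈ S) → c₁ (Sum.inl ⁻¹' S)) ∧
        ((¬ ∃ r, Sum.inr (some r) ∈ S) → c₀ (Sum.inl ⁻¹' S))))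
    tauto

/-- The two polynomials are the constants 0 and 1 on a point. -/
theorem edgeState_of_isEmpty [IsEmpty σ] {c₀ c₁ : Set σ → Prop} (h₀ : ¬ c₀ ∅) (h₁ : c₁ ∅) :
    edgeState K c₀ c₁ = (0, 0, 1) := by
  have hS (S : Set σ) : S = ∅ := Set.eq_empty_of_isEmpty S
  have hF : complementSum K (IsMinimalFor c₀) = 0 := by
    rw [← complementSum_false (σ := σ)]
    exact complementSum_congr fun S => iff_false_intro fun h => h₀ (hS S ▸ h.1)
  have hH : complementSum K (fun S => ¬ c₀ S ∧ IsMinimalFor c₁ S) = 1 := by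
    rw [complementSum_congr (q := fun _ => True) fun S => iff_true_intro
      ⟨hS S ▸ h₀, hS S ▸ h₁, fun f => isEmptyElim f⟩]
    simp [complementSum]
  rw [edgeState, hF, hH]
  refine Prod.ext ?_ (Prod.ext ?_ ?_)
  · exact pieceClass_eq_zero fun p _ _ => by simp
  · exact pieceClass_eq_zero fun p _ _ => p.zero_mem
  · simp only [pairState, Set.singleton_zero, Ideal.span_zero]
    rw [pieceClass_bot_one, affineClass_congr (MvPolynomial.isEmptyAlgEquiv K σ), affineClass_self]

end EdgeSets

/-! ### Connectivity of graphs and the state at an edge -/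

namespace Multigraph

/-- The edges in `S` connect all vertices. -/
def Connects (G : Multigraph) (S : Set G.E) : Prop :=
  ∀ a b, G.Joined S a b

theorem joined_of_mem {G : Multigraph} {S : Set G.E} {e : G.E} (he : e ∈ S) :
    G.Joined S (G.src e) (G.tgt e) :=
  .rel _ _ ⟨e, he, rfl, rfl⟩

theorem Joined.map {G G' : Multigraph} {S : Set G.E} {S' : Set G'.E} (f : G.V → G'.V)
    (h : ∀ e ∈ S, G'.Joined S' (f (G.src e)) (f (G.tgt e))) {a b : G.V} (hab : G.Joined S a b) :
    G'.Joined S' (f a) (f b) := by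
  induction hab with
  | rel _ _ h' =>
    obtain ⟨e, he, rfl, rfl⟩ := h'
    exact h e he
  | refl => exact .refl _
  | symm _ _ _ ih => exact ih.symm
  | trans _ _ _ _ _ ih ih' => exact ih.trans _ _ _ ih'

theorem Joined.iff_of_forall {G : Multigraph} {S : Set G.E} {P : G.V → Prop}
    (h : ∀ e ∈ S, P (G.src e) ↔ P (G.tgt e)) {a b : G.V} (hab : G.Joined S a b) : P a ↔ P b := by
  induction hab with
  | rel _ _ h' =>
    obtain ⟨e, he, rfl, rfl⟩ := h'
    exact h e he
  | refl => rfl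
  | symm _ _ _ ih => exact ih.symm
  | trans _ _ _ _ _ ih ih' => exact ih.trans ih'

/-- If the ends of e stay joined after removing e, every path through e can be rerouted, so the
smaller set still connects the graph. -/
theorem isSpanningTree_iff (G : Multigraph) (S : Set G.E) :
    G.IsSpanningTree S ↔ IsMinimalFor G.Connects S := by
  refine and_congr_right fun h => forall₂_congr fun e he => not_congr ⟨fun h' a b => ?_, fun h' => h' _ _⟩
  refine (h a b).map id fun f hf => ?_
  by_cases hfe : f = e
  · exact hfe ▸ h'
  · exact joined_of_mem (S := S \ {e}) ⟨hf, hfe⟩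

variable (K : Type u) [Field K]

theorem grothendieckClass_eq (G : Multigraph) :
    G.grothendieckClass K =
      affineClass K (Localization.Away (complementSum K (IsMinimalFor G.Connects))) := by
  rw [grothendieckClass, cls_hypersurfaceComplement]
  have : G.symanzik K = complementSum K (IsMinimalFor G.Connects) :=
    complementSum_congr G.isSpanningTree_iff
  rw [this]

open Classical in
/-- The state of the pair `(Ψ_{G∖e}, Ψ_{G/e})` of polynomials in the edges of `G` other than `e`. -/
def stateAt (G : Multigraph) (e : G.E) :
    GrothendieckRing K × GrothendieckRing K × GrothendieckRing K :=
  edgeState K (fun S : Set {x : G.E // x ≠ e} => G.Connects (Subtype.val '' S))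
    (fun S => G.Connects (insert e (Subtype.val '' S)))

variable {K}

theorem grothendieckClass_eq_stateAt (G : Multigraph) (e : G.E) :
    G.grothendieckClass K = torusClass K * ((G.stateAt K e).1 + (G.stateAt K e).2.1) +
      (torusClass K + 1) * (G.stateAt K e).2.2 := by
  classical
  let φ : G.E ≃ Option {x : G.E // x ≠ e} := (Equiv.optionSubtypeNe e).symm
  rw [grothendieckClass_eq, ← pieceClass_bot,
    ← pieceClass_congr_algEquiv (MvPolynomial.renameEquiv K φ), Ideal.map_bot,
    renameEquiv_complementSum, ← complementSum_congr (isMinimalFor_preimage φ _), pieceClass_bot]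
  have h (S : Set {x : G.E // x ≠ e}) : φ ⁻¹' (some '' S) = Subtype.val '' S := by
    rw [← Equiv.image_symm_eq_preimage, Set.image_image]
    simp [φ]
  refine affineClass_complementSum (fun S => ?_) (fun S => ?_)
  · rw [h]
  · rw [← h]
    congr! 1
    ext x
    simp [φ, Equiv.optionSubtypeNe_symm_apply]

end Multigraph

/-! ### Effect of inserting a string of bananas -/

namespace BananaGraph

open Multigraph

variable {K : Type u} [Field K] (G : BananaGraph) (e : G.E) (m s : ℕ)

/-- The graph obtained from `G` by replacing `e` by a string consisting of an edge, `m` parallel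
edges and an edge. -/
abbrev insertString : BananaGraph := G.bananify e [1, m, 1] s

namespace insertString

/-- The first edge of the string replacing `e`. -/
def firstEdge : (G.insertString e m s).E := Sum.inr ⟨(0 : Fin 3), (0 : Fin 1)⟩

/-- The parallel edges in the middle of the string replacing `e`. -/
def middleEdge (i : Fin m) : (G.insertString e m s).E := Sum.inr ⟨(1 : Fin 3), i⟩

/-- The last edge of the string replacing `e`. -/
def lastEdge : (G.insertString e m s).E := Sum.inr ⟨(2 : Fin 3), (0 : Fin 1)⟩

/-- The edges of `G` other than `e`. -/
def oldEdge (x : {x : G.E // x ≠ e}) : (G.insertString e m s).E := Sum.inl x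

/-- The vertices of `G`. -/
def oldVertex (a : G.V) : (G.insertString e m s).V := Sum.inl a

/-- The two inner vertices of the string replacing `e`. -/
def newVertex (j : Fin 2) : (G.insertString e m s).V := Sum.inr j

variable {G e m s}

theorem forall_edges {P : (G.insertString e m s).E → Prop} (h : ∀ x, P (oldEdge G e m s x))
    (h₀ : P (firstEdge G e m s)) (h₁ : ∀ i, P (middleEdge G e m s i))
    (h₂ : P (lastEdge G e m s)) : ∀ y, P y := by
  rintro (x | ⟨j, i⟩)
  · exact h x
  · change Fin 3 at j
    fin_cases j
    · obtain rfl : i = (0 : Fin 1) := Subsingleton.elim (α := Fin 1) _ _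
      exact h₀
    · exact h₁ i
    · obtain rfl : i = (0 : Fin 1) := Subsingleton.elim (α := Fin 1) _ _
      exact h₂

theorem forall_vertices {P : (G.insertString e m s).V → Prop} (h : ∀ a, P (oldVertex G e m s a))
    (h₀ : P (newVertex G e m s 0)) (h₁ : P (newVertex G e m s 1)) : ∀ y, P y := by
  rintro (a | j)
  · exact h a
  · change Fin 2 at j
    fin_cases j
    · exact h₀
    · exact h₁

variable {S : Set (G.insertString e m s).E}

/-- The two new vertices are sent into `G` by f, the old ones are kept; paths are carried along. -/
theorem connects_of_collapse {R : Set G.E} (f : Fin 2 → G.V)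
    (h : ∀ x, oldEdge G e m s x ∈ S → G.Joined R (G.src x) (G.tgt x))
    (h₀ : firstEdge G e m s ∈ S → G.Joined R (G.src e) (f 0))
    (h₁ : ∀ i, middleEdge G e m s i ∈ S → G.Joined R (f 0) (f 1))
    (h₂ : lastEdge G e m s ∈ S → G.Joined R (f 1) (G.tgt e))
    (hS : (G.insertString e m s).Connects S) : G.Connects R := fun a b =>
  (hS (oldVertex G e m s a) (oldVertex G e m s b)).map (G' := G.toMultigraph) (Sum.elim id f)
    (forall_edges h h₀ h₁ h₂)

theorem connects_of_expand {R : Set G.E}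
    (h : ∀ x ∈ R, (G.insertString e m s).Joined S (oldVertex G e m s (G.src x))
      (oldVertex G e m s (G.tgt x)))
    (h₀ : ∃ a, (G.insertString e m s).Joined S (newVertex G e m s 0) (oldVertex G e m s a))
    (h₁ : ∃ a, (G.insertString e m s).Joined S (newVertex G e m s 1) (oldVertex G e m s a))
    (hR : G.Connects R) : (G.insertString e m s).Connects S := by
  have hold (a b : G.V) : (G.insertString e m s).Joined S (oldVertex G e m s a)
      (oldVertex G e m s b) := (hR a b).map (G' := (G.insertString e m s).toMultigraph) _ h
  have key : ∀ y, ∃ a, (G.insertString e m s).Joined S y (oldVertex G e m s a) :=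
    forall_vertices (fun a => ⟨a, .refl _⟩) h₀ h₁
  intro y z
  obtain ⟨a, ha⟩ := key y
  obtain ⟨b, hb⟩ := key z
  exact ha.trans _ _ _ ((hold a b).trans _ _ _ hb.symm)

theorem joined_first (h : firstEdge G e m s ∈ S) : (G.insertString e m s).Joined S
    (oldVertex G e m s (G.src e)) (newVertex G e m s 0) :=
  joined_of_mem (G := (G.insertString e m s).toMultigraph) h

theorem joined_middle {i : Fin m} (h : middleEdge G e m s i ∈ S) : (G.insertString e m s).Joined S
    (newVertex G e m s 0) (newVertex G e m s 1) :=
  joined_of_mem (G := (G.insertString e m s).toMultigraph) h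

theorem joined_last (h : lastEdge G e m s ∈ S) : (G.insertString e m s).Joined S
    (newVertex G e m s 1) (oldVertex G e m s (G.tgt e)) :=
  joined_of_mem (G := (G.insertString e m s).toMultigraph) h

variable (S) in
/-- The edges of `G` other than `e` that belong to `S`. -/
def oldPart : Set G.E := Subtype.val '' (oldEdge G e m s ⁻¹' S)

theorem joined_oldPart {x : G.E} (hx : x ∈ oldPart S) : (G.insertString e m s).Joined S
    (oldVertex G e m s (G.src x)) (oldVertex G e m s (G.tgt x)) := by
  obtain ⟨x, hx, rfl⟩ := hx
  exact joined_of_mem (G := (G.insertString e m s).toMultigraph) hx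

/-- P cuts out a non-empty set of new vertices that no edge of S leaves. -/
theorem not_connects (P : (G.insertString e m s).V → Prop)
    (h : ∀ a, ¬ P (oldVertex G e m s a)) (hP : ∃ y, P y)
    (h₀ : firstEdge G e m s ∈ S → ¬ P (newVertex G e m s 0))
    (h₁ : ∀ i, middleEdge G e m s i ∈ S → (P (newVertex G e m s 0) ↔ P (newVertex G e m s 1)))
    (h₂ : lastEdge G e m s ∈ S → ¬ P (newVertex G e m s 1)) :
    ¬ (G.insertString e m s).Connects S := by
  intro hS
  obtain ⟨y, hy⟩ := hP
  have key := (hS y (oldVertex G e m s (G.src e))).iff_of_forall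
    (G := (G.insertString e m s).toMultigraph) (P := P) (forall_edges
    (fun x _ => iff_of_false (h _) (h _)) (fun h' => iff_of_false (h _) (h₀ h')) h₁
    (fun h' => iff_of_false (h₂ h') (h _)))
  exact h _ (key.1 hy)

/-- The case distinction is nested (middle edges, then first, then last) exactly as
`edgeState_parallel_iterate` applied after two uses of `edgeState_series` produces it. -/
theorem connects_iff : (G.insertString e m s).Connects S ↔
    ((∃ i, middleEdge G e m s i ∈ S) →
      (firstEdge G e m s ∈ S → (lastEdge G e m s ∈ S → G.Connects (insert e (oldPart S))) ∧
        (lastEdge G e m s ∉ S → G.Connects (oldPart S))) ∧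
      (firstEdge G e m s ∉ S → lastEdge G e m s ∈ S ∧ G.Connects (oldPart S))) ∧
    ((¬ ∃ i, middleEdge G e m s i ∈ S) →
      firstEdge G e m s ∈ S ∧ lastEdge G e m s ∈ S ∧ G.Connects (oldPart S)) := by
  have hj (R : Set G.E) (hR : oldPart S ⊆ R) (x : {x : G.E // x ≠ e})
      (hx : oldEdge G e m s x ∈ S) : G.Joined R (G.src x) (G.tgt x) :=
    joined_of_mem (hR ⟨x, hx, rfl⟩)
  by_cases hZ : ∃ i, middleEdge G e m s i ∈ S <;> by_cases hX : firstEdge G e m s ∈ S <;>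
    by_cases hY : lastEdge G e m s ∈ S <;> simp only [hX, hY, hZ, not_true_eq_false,
      not_false_eq_true, true_implies, false_implies, true_and, and_true, false_and, iff_false]
  · obtain ⟨i, hi⟩ := hZ
    have hp := (joined_first hX).trans _ _ _ (joined_middle hi)
    refine ⟨connects_of_collapse (fun _ => G.src e) (hj _ (Set.subset_insert _ _))
      (fun _ => .refl _) (fun _ _ => .refl _) (fun _ => joined_of_mem (Set.mem_insert _ _)),
      connects_of_expand ?_ ⟨_, (joined_first hX).symm⟩ ⟨_, joined_last hY⟩⟩
    rintro x (rfl | hx)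
    · exact hp.trans _ _ _ (joined_last hY)
    · exact joined_oldPart hx
  · obtain ⟨i, hi⟩ := hZ
    have hp := (joined_first hX).trans _ _ _ (joined_middle hi)
    exact ⟨connects_of_collapse (fun _ => G.src e) (hj _ subset_rfl) (fun _ => .refl _)
      (fun _ _ => .refl _) (fun h => (hY h).elim),
      connects_of_expand (fun _ => joined_oldPart) ⟨_, (joined_first hX).symm⟩ ⟨_, hp.symm⟩⟩
  · obtain ⟨i, hi⟩ := hZ
    have hp := (joined_middle hi).trans _ _ _ (joined_last hY)
    exact ⟨connects_of_collapse (fun _ => G.tgt e) (hj _ subset_rfl) (fun h => (hX h).elim)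
      (fun _ _ => .refl _) (fun _ => .refl _),
      connects_of_expand (fun _ => joined_oldPart) ⟨_, hp⟩ ⟨_, joined_last hY⟩⟩
  · exact not_connects (fun y => ∃ j, y = newVertex G e m s j) (fun a ⟨j, h⟩ => Sum.inl_ne_inr h)
      ⟨_, 0, rfl⟩ (fun h => (hX h).elim)
      (fun _ _ => iff_of_true ⟨_, rfl⟩ ⟨_, rfl⟩) (fun h => (hY h).elim)
  · exact ⟨connects_of_collapse ![G.src e, G.tgt e] (hj _ subset_rfl) (fun _ => .refl _)
      (fun i hi => (hZ ⟨i, hi⟩).elim) (fun _ => .refl _),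
      connects_of_expand (fun _ => joined_oldPart) ⟨_, (joined_first hX).symm⟩ ⟨_, joined_last hY⟩⟩
  · exact not_connects (fun y => y = newVertex G e m s 1) (fun a h => Sum.inl_ne_inr h)
      ⟨_, rfl⟩ (fun _ h => zero_ne_one (α := Fin 2) (Sum.inr_injective h))
      (fun i hi => (hZ ⟨i, hi⟩).elim) (fun h => (hY h).elim)
  · exact not_connects (fun y => y = newVertex G e m s 0) (fun a h => Sum.inl_ne_inr h)
      ⟨_, rfl⟩ (fun h => (hX h).elim)
      (fun i hi => (hZ ⟨i, hi⟩).elim) (fun _ h => one_ne_zero (α := Fin 2) (Sum.inr_injective h))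
  · exact not_connects (fun y => ∃ j, y = newVertex G e m s j) (fun a ⟨j, h⟩ => Sum.inl_ne_inr h)
      ⟨_, 0, rfl⟩ (fun h => (hX h).elim)
      (fun _ _ => iff_of_true ⟨_, rfl⟩ ⟨_, rfl⟩) (fun h => (hY h).elim)

theorem firstEdge_ne (k : Fin m) : firstEdge G e m s ≠ middleEdge G e m s k := fun h =>
  zero_ne_one (α := Fin 3) (congrArg Sigma.fst (Sum.inr_injective h))

theorem lastEdge_ne (k : Fin m) : lastEdge G e m s ≠ middleEdge G e m s k := fun h => by
  have : (2 : Fin 3) = 1 := congrArg Sigma.fst (Sum.inr_injective h)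
  exact absurd this (by decide)

theorem firstEdge_ne_lastEdge : firstEdge G e m s ≠ lastEdge G e m s := fun h => by
  have : (0 : Fin 3) = 2 := congrArg Sigma.fst (Sum.inr_injective h)
  exact absurd this (by decide)

theorem middleEdge_injective : Function.Injective (middleEdge G e m s) := fun _ _ h =>
  eq_of_heq (Sigma.mk.inj (Sum.inr_injective h)).2

variable (G e m s) in
/-- The edges other than the `k`-th parallel edge of the string. -/
def otherEdge (k : Fin m) : Option (Option {x : G.E // x ≠ e}) ⊕ {j : Fin m // j ≠ k} →
    {y : (G.insertString e m s).E // y ≠ middleEdge G e m s k}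
  | .inl none => ⟨firstEdge G e m s, firstEdge_ne k⟩
  | .inl (some none) => ⟨lastEdge G e m s, lastEdge_ne k⟩
  | .inl (some (some x)) => ⟨oldEdge G e m s x, Sum.inl_ne_inr⟩
  | .inr j => ⟨middleEdge G e m s j, fun h => j.2 (middleEdge_injective h)⟩

theorem otherEdge_bijective (k : Fin m) : Function.Bijective (otherEdge G e m s k) := by
  refine ⟨fun x y h => ?_, fun ⟨y, hy⟩ => ?_⟩
  · rw [Subtype.ext_iff] at h
    rcases x with (_ | _ | x) | x <;> rcases y with (_ | _ | y) | y
    · rfl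
    · exact (firstEdge_ne_lastEdge h).elim
    · exact (Sum.inr_ne_inl h).elim
    · exact (firstEdge_ne _ h).elim
    · exact (firstEdge_ne_lastEdge h.symm).elim
    · rfl
    · exact (Sum.inr_ne_inl h).elim
    · exact (lastEdge_ne _ h).elim
    · exact (Sum.inl_ne_inr h).elim
    · exact (Sum.inl_ne_inr h).elim
    · rw [Sum.inl_injective h]
    · exact (Sum.inl_ne_inr h).elim
    · exact (firstEdge_ne _ h.symm).elim
    · exact (lastEdge_ne _ h.symm).elim
    · exact (Sum.inr_ne_inl h).elim
    · rw [Subtype.ext (middleEdge_injective h)]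
  · revert y
    refine forall_edges (fun x _ => ⟨.inl (some (some x)), rfl⟩) (fun _ => ⟨.inl none, rfl⟩)
      (fun i hi => ⟨.inr ⟨i, ?_⟩, rfl⟩) (fun _ => ⟨.inl (some none), rfl⟩)
    rintro rfl
    exact hi rfl

/-- Seen from the k-th parallel edge, the first and last edges are in series with it and the other m
- 1 are parallel to it. The step lemmas are read backwards to build an edge set of the shape of the
domain of `otherEdge`; what remains is `connects_iff`. -/
theorem stateAt_middleEdge (k : Fin m) :
    (G.insertString e m s).stateAt K (middleEdge G e m s k) =
      (parallelStep (torusClass K))^[m - 1]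
        (seriesStep (torusClass K) (seriesStep (torusClass K) (G.stateAt K e))) := by
  classical
  let φ := Equiv.ofBijective _ (otherEdge_bijective (G := G) (e := e) (s := s) k)
  have hcard : Fintype.card {j : Fin m // j ≠ k} = m - 1 := by simp
  rw [← hcard, stateAt, stateAt, ← edgeState_series, ← edgeState_series,
    ← edgeState_parallel_iterate, ← edgeState_equiv φ]
  have hmem (S : Set {y : (G.insertString e m s).E // y ≠ middleEdge G e m s k}) (z) :
      (φ z).1 ∈ Subtype.val '' S ↔ z ∈ φ ⁻¹' S := Subtype.val_injective.mem_set_image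
  have hX (S) : firstEdge G e m s ∈ Subtype.val '' S ↔ Sum.inl none ∈ φ ⁻¹' S := hmem S (.inl none)
  have hY (S) : lastEdge G e m s ∈ Subtype.val '' S ↔ Sum.inl (some none) ∈ φ ⁻¹' S :=
    hmem S (.inl (some none))
  have hk (S : Set {y : (G.insertString e m s).E // y ≠ middleEdge G e m s k}) :
      middleEdge G e m s k ∉ Subtype.val '' S := fun ⟨y, _, hy⟩ => y.2 hy
  have hZ (S : Set {y : (G.insertString e m s).E // y ≠ middleEdge G e m s k}) :
      (∃ i, middleEdge G e m s i ∈ Subtype.val '' S) ↔ ∃ r, Sum.inr r ∈ φ ⁻¹' S := by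
    refine ⟨fun ⟨i, hi⟩ => ?_, fun ⟨r, hr⟩ => ⟨r.1, (hmem S (.inr r)).2 hr⟩⟩
    have hik : i ≠ k := by
      rintro rfl
      exact hk S hi
    exact ⟨⟨i, hik⟩, (hmem S (.inr ⟨i, hik⟩)).1 hi⟩
  have hold (S : Set {y : (G.insertString e m s).E // y ≠ middleEdge G e m s k}) :
      oldPart (Subtype.val '' S) =
        Subtype.val '' (some ⁻¹' (some ⁻¹' (Sum.inl ⁻¹' (φ ⁻¹' S)))) :=
    congrArg (Subtype.val '' ·) (Set.ext fun x => hmem S (.inl (some (some x))))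
  refine edgeState_congr (fun S => ?_) (fun S => ?_)
  · rw [connects_iff, hold, hZ, hX, hY]
    rfl
  · have hX' : firstEdge G e m s ∈ insert (middleEdge G e m s k) (Subtype.val '' S) ↔
        Sum.inl none ∈ φ ⁻¹' S := by
      rw [Set.mem_insert_iff, or_iff_right (firstEdge_ne k)]
      exact hX S
    have hY' : lastEdge G e m s ∈ insert (middleEdge G e m s k) (Subtype.val '' S) ↔
        Sum.inl (some none) ∈ φ ⁻¹' S := by
      rw [Set.mem_insert_iff, or_iff_right (lastEdge_ne k)]
      exact hY S
    have hZ' : ∃ i, middleEdge G e m s i ∈ insert (middleEdge G e m s k) (Subtype.val '' S) :=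
      ⟨k, Set.mem_insert _ _⟩
    have hold' : oldPart (insert (middleEdge G e m s k) (Subtype.val '' S)) =
        oldPart (Subtype.val '' S) :=
      congrArg (Subtype.val '' ·) (Set.ext fun _ => or_iff_right Sum.inl_ne_inr)
    rw [connects_iff, hX', hY', hold', hold]
    simp only [Set.mem_preimage, hZ', true_implies, not_true_eq_false, false_implies, and_true]

end insertString

theorem stateAt_singleEdge (e : singleEdge.E) : singleEdge.stateAt K e = (0, 0, 1) := by
  classical
  have : IsEmpty {x : singleEdge.E // x ≠ e} := ⟨fun x => x.2 (Subsingleton.elim (α := Unit) _ _)⟩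
  refine edgeState_of_isEmpty (fun h => ?_) ?_
  · rw [Set.image_empty] at h
    have h' := (h false true).iff_of_forall (P := fun b : Bool => b = false) (by simp)
    exact Bool.noConfusion (h'.1 rfl)
  · rw [Set.image_empty, insert_empty_eq]
    have h : singleEdge.Joined {e} false true := joined_of_mem (Set.mem_singleton e)
    rintro (_ | _) (_ | _)
    exacts [.refl _, h, h.symm, .refl _]

end BananaGraph

/-! ### The graphs of the melonic construction -/

theorem gammaConstruction_succ (v n : ℕ) : gammaConstruction v (n + 1) =
    gammaConstruction v n ++ [⟨[1, v - 1, 1], n, if n = 0 then 1 else 2⟩] := by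
  simp [gammaConstruction, List.range_succ]

theorem length_gammaConstruction (v n : ℕ) : (gammaConstruction v n).length = n := by
  simp [gammaConstruction]

open BananaGraph BananaGraph.insertString in
/-- The edges of `Γᵛₙ` that can be replaced in the next stage exist, and the state at each of them
is obtained by iterating `stringStep`. -/
theorem IsMelonicGraph.stateAt_eq {K : Type u} [Field K] {T : List MelonicTuple} {G : BananaGraph}
    (h : IsMelonicGraph T G) {v n : ℕ} (hv : 4 ≤ v) (hT : T = gammaConstruction v n) :
    (∀ e, (G.label e).1 ≤ n) ∧ (∃ e, G.label e = (n, if n = 0 then 1 else 2)) ∧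
      ∀ e, G.label e = (n, if n = 0 then 1 else 2) → G.stateAt K e =
        (stringStep v (torusClass K))^[n] (0, 0, 1) := by
  induction h generalizing n with
  | nil =>
    obtain rfl : n = 0 := by rw [← length_gammaConstruction v n, ← hT, List.length_nil]
    exact ⟨fun _ => le_rfl, ⟨(), rfl⟩, fun e _ => stateAt_singleEdge e⟩
  | @snoc T G hG t hne hpos e he ih =>
    obtain ⟨n, rfl⟩ : ∃ k, n = k + 1 := by
      have := congrArg List.length hT
      rw [length_gammaConstruction, List.length_append, List.length_singleton] at this
      exact ⟨_, this.symm⟩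
    rw [gammaConstruction_succ] at hT
    obtain ⟨rfl, ht⟩ := List.append_inj' hT rfl
    obtain rfl := List.singleton_injective ht
    obtain ⟨h1, -, h3⟩ := ih rfl
    rw [length_gammaConstruction, if_neg n.succ_ne_zero]
    change (∀ y, ((G.insertString e (v - 1) (n + 1)).label y).1 ≤ n + 1) ∧
      (∃ y, (G.insertString e (v - 1) (n + 1)).label y = (n + 1, 2)) ∧
      ∀ y, (G.insertString e (v - 1) (n + 1)).label y = (n + 1, 2) →
        (G.insertString e (v - 1) (n + 1)).stateAt K y = _
    refine ⟨?_, ⟨middleEdge G e _ _ ⟨0, by omega⟩, rfl⟩, ?_⟩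
    · exact forall_edges (fun x => (h1 x).trans n.le_succ) le_rfl (fun _ => le_rfl) le_rfl
    -- Only middle edges carry the label (n + 1, 2): old edges have stage at most n, and the end
    -- edges of the string belong to bananas 1 and 3.
    · refine forall_edges (fun x hx => ?_) (fun h => ?_) (fun k _ => ?_) (fun h => ?_)
      · have h4 : (G.label x).1 = n + 1 := congrArg Prod.fst hx
        exact absurd (h1 x) (by omega)
      · exact absurd (congrArg Prod.snd h) (by change ¬ (0 + 1 = 2); decide)
      · rw [stateAt_middleEdge, h3 e he, Function.iterate_succ_apply']
        rfl
      · exact absurd (congrArg Prod.snd h) (by change ¬ (2 + 1 = 2); decide)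

theorem exists_isMelonicGraph_gammaConstruction {v : ℕ} (hv : 4 ≤ v) (n : ℕ) :
    ∃ G, IsMelonicGraph (gammaConstruction v n) G := by
  induction n with
  | zero => exact ⟨_, .nil⟩
  | succ n ih =>
    obtain ⟨G, hG⟩ := ih
    -- Only the existence of a replaceable edge is used, so any field will do.
    obtain ⟨-, ⟨e, he⟩, -⟩ := hG.stateAt_eq (K := ℚ) hv rfl
    rw [gammaConstruction_succ]
    refine ⟨_, .snoc hG ⟨[1, v - 1, 1], n, if n = 0 then 1 else 2⟩ (by simp) ?_ e he⟩
    simp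
    omega

/-! ### The linear recursion for states -/

section Recursion

variable {R : Type*} [CommRing R]

/-- A parallel step multiplies x + w by T and x - Tw by -1, and sends x + y to T(x + y) + (T + 1)w,
whence the terms in T^k, (-1)^k and (k+1)T^k. Two series steps give both eigenvectors a factor T +
1, so solving for x and w requires no division. -/
theorem parallelStep_iterate_seriesStep (T x y w : R) (k : ℕ) :
    (parallelStep T)^[k + 1] (seriesStep T (seriesStep T (x, y, w))) =
      (T ^ (k + 2) * (T * (x + y) + (T + 1) * w) - (-1) ^ k * T * (x + y - (T + 1) * w),
        T ^ (k + 1) * (T + 1) ^ 2 * (x + y) +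
            (k + 1) * T ^ k * (T + 1) * (T * (x + y) + (T + 1) * w) -
            (T ^ (k + 1) + (-1) ^ k) * T * (x + y - (T + 1) * w) -
          (T ^ (k + 2) * (T * (x + y) + (T + 1) * w) - (-1) ^ k * T * (x + y - (T + 1) * w)),
        T ^ (k + 1) * (T * (x + y) + (T + 1) * w) + (-1) ^ k * T * (x + y - (T + 1) * w)) := by
  induction k with
  | zero =>
    simp only [Function.iterate_succ, Function.iterate_zero, Function.comp_apply, id,
      parallelStep, seriesStep]
    refine Prod.ext ?_ (Prod.ext ?_ ?_) <;> simp only [] <;> push_cast <;> ring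
  | succ k ih =>
    rw [Function.iterate_succ_apply', ih]
    simp only [parallelStep]
    refine Prod.ext ?_ (Prod.ext ?_ ?_) <;> simp only [] <;> push_cast <;> ring

/-- A linear combination of the entries of a state, which gives the class of a graph. -/
def totalClass (T : R) (s : R × R × R) : R :=
  T * (s.1 + s.2.1) + (T + 1) * s.2.2

/-- Cayley–Hamilton for the action of a string step on (x + y, w): the two coefficients are its
trace and determinant, with v = i + 4. -/
theorem totalClass_stringStep_stringStep (T : R) (i : ℕ) (s : R × R × R) :
    totalClass T (stringStep (i + 4) T (stringStep (i + 4) T s)) =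
      (T ^ (i + 2) * (T + 1) ^ 2 + (i + 2) * T ^ (i + 2) * (T + 1) - T ^ (i + 3) + (-1) ^ i * T +
          T * (T + 1) * (T ^ (i + 1) + (-1) ^ i)) * totalClass T (stringStep (i + 4) T s) -
        T ^ 2 * (T + 1) ^ 2 * ((-1) ^ i * T ^ i * ((T + 1) ^ 2 + (i + 1) * (T + 1) + T)
          + T ^ (2 * i + 2)) * totalClass T s := by
  obtain ⟨x, y, w⟩ := s
  simp only [stringStep, show i + 4 - 2 = i + 1 + 1 by omega,
    parallelStep_iterate_seriesStep, totalClass]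
  push_cast
  ring

end Recursion

/-! ### The generating function: recursion, comparison and degree -/

section GeneratingFunction

open Polynomial

theorem one_add_X_mul_sum (n : ℕ) :
    (1 + X) * ∑ j ∈ Finset.range n, (-1) ^ j * X ^ j = (1 - (-1) ^ n * X ^ n : ℤ[X]) := by
  induction n with
  | zero => simp
  | succ n ih =>
    rw [Finset.sum_range_succ, mul_add, ih]
    ring

theorem one_add_X_sq_mul_sum_add_two (n : ℕ) :
    (1 + X) ^ 2 * ∑ j ∈ Finset.range n, (-1) ^ j * ((j : ℤ[X]) + 2) * X ^ j =
      X + 2 - (-1) ^ n * X ^ n * (((n : ℤ[X]) + 1) * X + ((n : ℤ[X]) + 2)) := by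
  induction n with
  | zero => simp
  | succ n ih =>
    rw [Finset.sum_range_succ, mul_add, ih]
    push_cast
    ring

theorem one_add_X_sq_mul_sum_sub (n : ℕ) :
    (1 + X) ^ 2 * ∑ j ∈ Finset.range n, (-1) ^ j * ((n : ℤ[X]) - (j : ℤ[X])) * X ^ j =
      (n : ℤ[X]) * (1 + X) + X * (1 - (-1) ^ n * X ^ n) := by
  induction n with
  | zero => simp
  | succ n ih =>
    have h : ∑ j ∈ Finset.range (n + 1), (-1) ^ j * (((n + 1 : ℕ) : ℤ[X]) - (j : ℤ[X])) * X ^ j =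
        ∑ j ∈ Finset.range n, (-1) ^ j * ((n : ℤ[X]) - (j : ℤ[X])) * X ^ j +
          ∑ j ∈ Finset.range (n + 1), (-1) ^ j * X ^ j := by
      rw [Finset.sum_range_succ, Finset.sum_range_succ _ n, ← add_assoc, ← Finset.sum_add_distrib]
      congr 1
      · refine Finset.sum_congr rfl fun j _ => ?_
        push_cast
        ring
      · push_cast
        ring
    rw [h, mul_add, ih, sq, mul_assoc, one_add_X_mul_sum]
    push_cast
    ring

/-- Minus the coefficient of `r` in the numerator. -/
def numeratorCoeff (v : ℕ) : ℤ[X] := ∑ i ∈ Finset.range (v - 3), (-1) ^ (v - i) * X ^ i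

/-- The coefficient of `r` in the denominator. -/
def denominatorCoeffOne (v : ℕ) : ℤ[X] := -(v : ℤ[X]) * X ^ (v - 3)
  - ∑ i ∈ Finset.range (v - 2), (-1) ^ (v - i) * ((i : ℤ[X]) + 2) * X ^ i

/-- The coefficient of `r²` in the denominator. -/
def denominatorCoeffTwo (v : ℕ) : ℤ[X] := (-1) ^ v * X ^ (v - 4)
  + ∑ i ∈ Finset.range (v - 3), (-1) ^ (v - i) * ((v : ℤ[X]) - 3 - (i : ℤ[X])) * X ^ (v - 4 + i)

theorem neg_one_pow_sub {v j : ℕ} (h : j ≤ v) : (-1 : ℤ[X]) ^ (v - j) = (-1) ^ v * (-1) ^ j := by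
  obtain ⟨k, rfl⟩ := Nat.exists_eq_add_of_le h
  rw [Nat.add_sub_cancel_left, pow_add, mul_right_comm, ← mul_pow]
  simp

theorem one_add_X_mul_numeratorCoeff (i : ℕ) :
    (1 + X) * numeratorCoeff (i + 4) = (-1) ^ i + X ^ (i + 1) := by
  have h : numeratorCoeff (i + 4) =
      (-1) ^ i * ∑ j ∈ Finset.range (i + 1), (-1) ^ j * X ^ j := by
    rw [numeratorCoeff, Finset.mul_sum]
    refine Finset.sum_congr rfl fun j hj => ?_
    rw [neg_one_pow_sub (by have := Finset.mem_range.1 hj; omega)]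
    ring
  have h' : ((-1 : ℤ[X]) ^ i) * (-1) ^ i = 1 := by
    rw [← mul_pow, neg_one_mul, neg_neg, one_pow]
  rw [h, mul_left_comm, one_add_X_mul_sum]
  linear_combination X ^ (i + 1) * h'

theorem one_add_X_sq_mul_denominatorCoeffOne (i : ℕ) :
    (1 + X) ^ 2 * denominatorCoeffOne (i + 4) = -((i : ℤ[X]) + 4) * X ^ (i + 1) * (1 + X) ^ 2
      - ((-1) ^ i * (X + 2) - X ^ (i + 2) * (((i : ℤ[X]) + 3) * X + ((i : ℤ[X]) + 4))) := by
  have h : ∑ j ∈ Finset.range (i + 4 - 2), (-1) ^ (i + 4 - j) * ((j : ℤ[X]) + 2) * X ^ j =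
      (-1) ^ i * ∑ j ∈ Finset.range (i + 2), (-1) ^ j * ((j : ℤ[X]) + 2) * X ^ j := by
    rw [Finset.mul_sum]
    refine Finset.sum_congr rfl fun j hj => ?_
    rw [neg_one_pow_sub (by have := Finset.mem_range.1 hj; omega)]
    ring
  have h' : ((-1 : ℤ[X]) ^ i) * (-1) ^ i = 1 := by
    rw [← mul_pow, neg_one_mul, neg_neg, one_pow]
  have h2 := one_add_X_sq_mul_sum_add_two (i + 2)
  rw [denominatorCoeffOne, h]
  simp only [show i + 4 - 3 = i + 1 by omega]
  push_cast at h2 ⊢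
  linear_combination (-(-1) ^ i) * h2 + X ^ (i + 2) * (((i : ℤ[X]) + 3) * X + ((i : ℤ[X]) + 4)) * h'

theorem one_add_X_sq_mul_denominatorCoeffTwo (i : ℕ) :
    (1 + X) ^ 2 * denominatorCoeffTwo (i + 4) =
      (-1) ^ i * X ^ i * ((X + 1) ^ 2 + ((i : ℤ[X]) + 1) * (X + 1) + X) + X ^ (2 * i + 2) := by
  have h : ∑ j ∈ Finset.range (i + 4 - 3), (-1) ^ (i + 4 - j) *
      (((i + 4 : ℕ) : ℤ[X]) - 3 - (j : ℤ[X])) * X ^ (i + 4 - 4 + j) = (-1) ^ i * X ^ i *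
        ∑ j ∈ Finset.range (i + 1), (-1) ^ j * (((i + 1 : ℕ) : ℤ[X]) - (j : ℤ[X])) * X ^ j := by
    rw [Finset.mul_sum]
    refine Finset.sum_congr rfl fun j hj => ?_
    rw [neg_one_pow_sub (by have := Finset.mem_range.1 hj; omega)]
    push_cast
    ring
  have h' : ((-1 : ℤ[X]) ^ i) * (-1) ^ i = 1 := by
    rw [← mul_pow, neg_one_mul, neg_neg, one_pow]
  have h2 := one_add_X_sq_mul_sum_sub (i + 1)
  rw [denominatorCoeffTwo, h]
  simp only [show i + 4 - 4 = i by omega]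
  push_cast at h2 ⊢
  linear_combination ((-1) ^ i * X ^ i) * h2 + X ^ (2 * i + 2) * h'

/-- Comparison of coefficients in D · A = N. -/
theorem polyA_recursion (v : ℕ) : polyA v 0 = 1 ∧
    polyA v 1 = -numeratorCoeff v - denominatorCoeffOne v ∧
    ∀ n, polyA v (n + 2) =
      -denominatorCoeffOne v * polyA v (n + 1) - denominatorCoeffTwo v * polyA v n := by
  set A := seriesN v * PowerSeries.invOfUnit (seriesD v) 1 with hA
  have h : A + PowerSeries.C (denominatorCoeffOne v) * (PowerSeries.X * A) +
      PowerSeries.C (denominatorCoeffTwo v) * (PowerSeries.X * (PowerSeries.X * A)) =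
        1 - PowerSeries.C (numeratorCoeff v) * PowerSeries.X := by
    have h1 : seriesD v * A = seriesN v := by
      rw [hA, mul_left_comm, seriesD_mul_inv, mul_one]
    rw [seriesD, seriesN] at h1
    change (1 + PowerSeries.C (denominatorCoeffOne v) * _ +
      PowerSeries.C (denominatorCoeffTwo v) * _) * A = 1 - PowerSeries.C (numeratorCoeff v) * _ at h1
    linear_combination h1
  have h0 := congrArg (PowerSeries.coeff 0) h
  have h1 := congrArg (PowerSeries.coeff 1) h
  have h2 (n : ℕ) := congrArg (PowerSeries.coeff (n + 2)) h
  have hX1 : PowerSeries.coeff 1 (PowerSeries.X * A) = PowerSeries.coeff 0 A :=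
    PowerSeries.coeff_succ_X_mul 0 A
  have hX2 : PowerSeries.coeff 1 (PowerSeries.X * (PowerSeries.X * A)) = 0 := by
    rw [PowerSeries.coeff_succ_X_mul 0, PowerSeries.coeff_zero_X_mul]
  simp only [map_add, map_sub, PowerSeries.coeff_C_mul, PowerSeries.coeff_zero_X_mul,
    PowerSeries.coeff_zero_one, PowerSeries.coeff_zero_X, mul_zero, add_zero, sub_zero] at h0
  simp only [map_add, map_sub, PowerSeries.coeff_C_mul, hX1, hX2, h0, PowerSeries.coeff_one_X,
    PowerSeries.coeff_one, one_ne_zero, if_false] at h1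
  simp only [map_add, map_sub, PowerSeries.coeff_C_mul, PowerSeries.coeff_succ_X_mul,
    PowerSeries.coeff_one, PowerSeries.coeff_X, Nat.add_eq_zero_iff, OfNat.ofNat_ne_zero, and_false,
    if_false, show ∀ n : ℕ, ¬ n + 2 = 1 from fun n => by omega] at h2
  refine ⟨h0, ?_, fun n => ?_⟩
  · change PowerSeries.coeff 1 A = _
    linear_combination h1
  · change PowerSeries.coeff (n + 2) A =
      _ * PowerSeries.coeff (n + 1) A - _ * PowerSeries.coeff n A
    linear_combination h2 n

theorem seriesN_eq {v : ℕ} (hv : 4 ≤ v) : PowerSeries.C (1 + X) * seriesN v =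
    PowerSeries.C (1 + X) + PowerSeries.C ((-1) ^ (v - 3) - X ^ (v - 3)) * PowerSeries.X := by
  obtain ⟨i, rfl⟩ := Nat.exists_eq_add_of_le' hv
  have h := one_add_X_mul_numeratorCoeff i
  change _ * (1 - PowerSeries.C (numeratorCoeff (i + 4)) * PowerSeries.X) = _
  rw [mul_sub, mul_one, ← mul_assoc, ← map_mul, h, sub_eq_add_neg, ← neg_mul, ← map_neg]
  congr 3
  rw [show i + 4 - 3 = i + 1 by omega]
  ring

/-- Both sides obey the same second-order recursion with the same two initial values. The closed
forms of the coefficients are known only after multiplication by powers of 1 + T; the prefactor (T +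
1)^(2n+1) supplies these, so 1 + T is never cancelled. -/
theorem totalClass_eq {R : Type*} [CommRing R] (T : R) {v : ℕ} (hv : 4 ≤ v) (n : ℕ) :
    totalClass T ((stringStep v T)^[n] (0, 0, 1)) =
      T ^ n * (T + 1) ^ (2 * n + 1) * aeval T (polyA v n) := by
  obtain ⟨i, rfl⟩ := Nat.exists_eq_add_of_le' hv
  obtain ⟨h0, h1, h2⟩ := polyA_recursion (i + 4)
  have hN := congrArg (aeval T) (one_add_X_mul_numeratorCoeff i)
  have hD1 := congrArg (aeval T) (one_add_X_sq_mul_denominatorCoeffOne i)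
  have hD2 := congrArg (aeval T) (one_add_X_sq_mul_denominatorCoeffTwo i)
  simp only [map_mul, map_add, map_sub, map_neg, map_pow, map_one, aeval_X, map_natCast,
    map_ofNat] at hN hD1 hD2
  induction n using Nat.twoStepInduction with
  | zero => simp [totalClass, h0]
  | one =>
    rw [Function.iterate_one, stringStep, show i + 4 - 2 = i + 1 + 1 by omega,
      parallelStep_iterate_seriesStep, totalClass, h1]
    simp only [map_sub, map_neg]
    push_cast
    linear_combination T * (T + 1) ^ 2 * hN + T * (T + 1) * hD1
  | more n ih1 ih2 =>
    rw [Function.iterate_succ_apply', Function.iterate_succ_apply',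
      totalClass_stringStep_stringStep, ← Function.iterate_succ_apply' (stringStep (i + 4) T),
      ih1, ih2, h2]
    simp only [map_sub, map_neg, map_mul]
    linear_combination T ^ (n + 2) * (T + 1) ^ (2 * n + 3) * aeval T (polyA (i + 4) (n + 1)) * hD1 +
      T ^ (n + 2) * (T + 1) ^ (2 * n + 3) * aeval T (polyA (i + 4) n) * hD2

theorem degree_sum_lt (n : ℕ) (c : ℕ → ℤ) :
    (∑ j ∈ Finset.range n, C (c j) * X ^ j).degree < (n : WithBot ℕ) := by
  rw [← mem_degreeLT]
  refine Submodule.sum_mem _ fun j hj => mem_degreeLT.2 ?_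
  exact (degree_C_mul_X_pow_le j _).trans_lt (Nat.cast_lt.2 (Finset.mem_range.1 hj))

theorem degree_numeratorCoeff_lt (v : ℕ) : (numeratorCoeff v).degree < ((v - 3 : ℕ) : WithBot ℕ) := by
  have := degree_sum_lt (v - 3) fun j => (-1) ^ (v - j)
  simpa [numeratorCoeff] using this

/-- The top coefficient is -v from the separate term plus v - 1 from the last summand, that is, -1.
-/
theorem degree_denominatorCoeffOne {v : ℕ} (hv : 4 ≤ v) :
    (denominatorCoeffOne v).degree = ((v - 3 : ℕ) : WithBot ℕ) := by
  obtain ⟨i, rfl⟩ := Nat.exists_eq_add_of_le' hv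
  have h := degree_sum_lt (i + 1) fun j => (-1) ^ (i + 4 - j) * (j + 2)
  have h' : denominatorCoeffOne (i + 4) = -X ^ (i + 1) -
      ∑ j ∈ Finset.range (i + 1), C ((-1) ^ (i + 4 - j) * ((j : ℤ) + 2)) * X ^ j := by
    rw [denominatorCoeffOne, show i + 4 - 2 = i + 1 + 1 by omega, Finset.sum_range_succ,
      show i + 4 - (i + 1) = 3 by omega, show i + 4 - 3 = i + 1 by omega]
    simp
    ring
  rw [h', degree_sub_eq_left_of_degree_lt] <;> rw [degree_neg, degree_X_pow]
  · rfl
  · exact h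

theorem degree_denominatorCoeffTwo_lt {v : ℕ} (hv : 4 ≤ v) :
    (denominatorCoeffTwo v).degree < ((2 * (v - 3) : ℕ) : WithBot ℕ) := by
  obtain ⟨i, rfl⟩ := Nat.exists_eq_add_of_le' hv
  have h := degree_sum_lt (i + 1) fun j => (-1) ^ (i + 4 - j) * (i + 1 - j)
  have h' : denominatorCoeffTwo (i + 4) = X ^ i * (C ((-1) ^ (i + 4)) +
      ∑ j ∈ Finset.range (i + 1), C ((-1) ^ (i + 4 - j) * ((i : ℤ) + 1 - j)) * X ^ j) := by
    rw [denominatorCoeffTwo, mul_add, Finset.mul_sum]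
    simp only [Nat.add_sub_cancel, show i + 4 - 3 = i + 1 by omega]
    simp
    congr 1
    · ring
    · refine Finset.sum_congr rfl fun j _ => ?_
      ring
  have h2 : (C ((-1) ^ (i + 4)) +
      ∑ j ∈ Finset.range (i + 1), C ((-1) ^ (i + 4 - j) * ((i : ℤ) + 1 - j)) * X ^ j).degree <
        ((i + 1 : ℕ) : WithBot ℕ) :=
    (degree_add_le _ _).trans_lt (max_lt (degree_C_le.trans_lt (by exact_mod_cast i.succ_pos)) h)
  rw [h', degree_mul, degree_X_pow]
  refine lt_of_lt_of_le (WithBot.add_lt_add_left (by simp) h2) ?_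
  rw [← Nat.cast_add, Nat.cast_le]
  omega

/-- In the recursion the D₁ term has degree exactly (v-3)(n+2), and the D₂ term stays strictly
below, so no cancellation occurs at the top. -/
theorem degree_polyA {v : ℕ} (hv : 4 ≤ v) (n : ℕ) :
    (polyA v n).degree = (((v - 3) * n : ℕ) : WithBot ℕ) := by
  obtain ⟨h0, h1, h2⟩ := polyA_recursion v
  induction n using Nat.twoStepInduction with
  | zero => simp [h0]
  | one =>
    rw [h1, degree_sub_eq_right_of_degree_lt, degree_denominatorCoeffOne hv, mul_one]
    rw [degree_neg, degree_denominatorCoeffOne hv]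
    exact degree_numeratorCoeff_lt v
  | more n ih1 ih2 =>
    have h3 : (-denominatorCoeffOne v * polyA v (n + 1)).degree =
        (((v - 3) * (n + 2) : ℕ) : WithBot ℕ) := by
      rw [degree_mul, degree_neg, degree_denominatorCoeffOne hv, ih2, ← Nat.cast_add]
      congr 1
      ring
    rw [h2, degree_sub_eq_left_of_degree_lt, h3]
    rw [h3, degree_mul, ih1]
    refine lt_of_lt_of_eq (WithBot.add_lt_add_right (WithBot.natCast_ne_bot _)
      (degree_denominatorCoeffTwo_lt hv)) ?_
    rw [← Nat.cast_add]
    congr 1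
    ring

end GeneratingFunction

end

theorem mainTheorem11 (K : Type*) [Field K] (v : ℕ) (hv : 4 ≤ v) :
    PowerSeries.C (1 + Polynomial.X) * seriesN v =
        PowerSeries.C (1 + Polynomial.X)
          + PowerSeries.C ((-1) ^ (v - 3) - Polynomial.X ^ (v - 3)) * PowerSeries.X ∧
      ∀ n : ℕ,
        (∃ G : BananaGraph, IsMelonicGraph (gammaConstruction v n) G) ∧
        (∀ G : BananaGraph, IsMelonicGraph (gammaConstruction v n) G →
          G.grothendieckClass K =
            torusClass K ^ n * (torusClass K + 1) ^ (2 * n + 1)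
              * Polynomial.aeval (torusClass K) (polyA v n)) ∧
        (polyA v n).degree = (((v - 3) * n : ℕ) : WithBot ℕ) := by
  refine ⟨seriesN_eq hv, fun n => ⟨exists_isMelonicGraph_gammaConstruction hv n, fun G hG => ?_,
    degree_polyA hv n⟩⟩
  obtain ⟨-, ⟨e, he⟩, h⟩ := hG.stateAt_eq (K := K) hv rfl
  rw [G.grothendieckClass_eq_stateAt e, h e he]
  exact totalClass_eq _ hv n
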